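/- **Setting.** Let $M\subset\mathbb R^q$ be nonempty and compact with $\overline{\operatorname{int}M}=M$, with the Euclidean distance $d$, and let $m$ be Lebesgue measure on $M$ normalized by $m(M)=1$. Balls $B_\varepsilon(x)$, closures and open sets are taken in $M$; $\operatorname{supp}$ denotes the closed topological support of a measure. Let $T:M\to M$ be measurable and nonsingular with respect to $m$, with set of discontinuities $\mathcal D_T$ satisfying $m(\mathcal D_T)=0$, and let $\mathcal L:L^1_m\to L^1_m$ be its Perron–Frobenius operator, defined by $\int f\cdot\varphi\circ T\,dm=\int \mathcal Lf\cdot\varphi\,dm$ for all bounded measurable $\varphi$. For each $\varepsilon>0$ let $P_\varepsilon(x,\cdot)$, $x\in M$, be a Markov transition probability on $M$ such that * (P1) $P_\varepsilon(x,\cdot)$ has a density $p_\varepsilon(x,\cdot)$ with respect to $m$ for every $x\in M$, with $p_\varepsilon$ jointly measurable; * (P2) $\operatorname{supp}P_\varepsilon(x,\cdot)=\overline{B_\varepsilon(Tx)}$ for every $x\in M$. Put $\mathcal L_\varepsilon f(x)=\int_M p_\varepsilon(z,x)f(z)\,dm(z)$ for $f\in L^1_m$. Let $\mathcal B\subset L^1_m$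 be a dense linear subspace with a seminorm $|\cdot|$ such that * (B1) $1\in\mathcal B$; * (B2) every $f\in\mathcal B$ has a representative whose set of discontinuities is $m$-null; * (B3) $\mathcal B$ is complete for the norm $|f|+\|f\|_1$, and its closed unit ball for this norm is compact in $L^1_m$. Suppose that there are $\eta\in(0,1)$, $D\in(0,\infty)$ and $\varepsilon_1>0$ such that $\mathcal L$ and $\mathcal L_\varepsilon$ $(0<\varepsilon<\varepsilon_1)$ map $\mathcal B$ into itself and, for all $f\in\mathcal B$ and $0<\varepsilon<\varepsilon_1$, $$|\mathcal Lf|\le\eta|f|+D\|f\|_1\quad(\mathrm{LY}),\qquad |\mathcal L_\varepsilon f|\le\eta|f|+D\|f\|_1\quad(\mathrm{RLY}).$$ **Definitions.** An *ergodic acim* is a $T$-invariant ergodic probability measure $\mu\ll m$. An *acsm* of $P_\varepsilon$ is a probability measure $\mu\ll m$ with $\mu(A)=\int P_\varepsilon(x,A)\,d\mu(x)$ for all Borel $A$; it is *ergodic* if $\mu(A)\in\{0,1\}$ for every Borel $A$ with $P_\varepsilon(x,A)=1_A(x)$ for $\mu$-a.e. $x$. An *$\varepsilon$-pseudo-orbit*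 is a finite sequence $x_0,\dots,x_n$ in $M$ $(n\ge 0)$ such that $x_i\notin\mathcal D_T$ and $d(Tx_i,x_{i+1})<\varepsilon$ for $0\le i<n$. For ergodic acims $\mu,\nu$ write $\mu\to\nu$ if for every $\varepsilon>0$ some $\varepsilon$-pseudo-orbit starts in $\operatorname{supp}\mu$ and ends in $\operatorname{supp}\nu$, and $\mu\sim\nu$ if $\mu\to\nu$ and $\nu\to\mu$. For an equivalence class $C$ of ergodic acims let $\tilde\Lambda=\bigcup_{\mu\in C}\operatorname{supp}\mu$. Write $C\to C'$ if $\mu\to\nu$ for all $\mu\in C$, $\nu\in C'$. The class $C$ (or the set $\tilde\Lambda$) is a *least element* if there is no class $C'\ne C$ with $C\to C'$. **Theorem.** Let $C$ be an equivalence class of ergodic acims and $\tilde\Lambda$ the corresponding set. 1. If $\tilde\Lambda$ is a least element, there is $\varepsilon_0>0$ such that for every $0<\varepsilon<\varepsilon_0$ there is an open set $\mathcal U_\varepsilon\supset\tilde\Lambda$ which is forward invariant, in the sense that $B_\varepsilon(Tx)\subset\mathcal U_\varepsilon$ for every $x\in\mathcal U_\varepsilon\setminus\mathcal D_T$, and which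 supports a unique ergodic acsm: there is exactly one ergodic acsm $\mu$ of $P_\varepsilon$ with $\mu(M\setminus\mathcal U_\varepsilon)=0$. 2. If $\tilde\Lambda$ is not a least element, there is $\varepsilon_0>0$ such that $\mu(\tilde\Lambda)=0$ for every $0<\varepsilon<\varepsilon_0$ and every acsm $\mu$ of $P_\varepsilon$. Moreover $\nu(\tilde\Lambda)=0$ for every weak limit $\nu$ of acsms $\mu_k$ of $P_{\varepsilon_k}$ along a sequence $\varepsilon_k\to0^+$. -/

import Mathlib

open MeasureTheory ProbabilityTheory Filter Topology
open scoped ENNReal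

namespace PseudoOrbits

noncomputable section

/-- Lebesgue measure on `M ⊆ ℝ^q`, as a measure on the subtype `M`, normalized to have total mass
one (when `M` has positive finite volume). -/
def normalizedLebesgue {q : ℕ} (M : Set (EuclideanSpace ℝ (Fin q))) : Measure M :=
  (volume M)⁻¹ • (volume : Measure (EuclideanSpace ℝ (Fin q))).comap Subtype.val

section Operators

variable {X : Type*} [MeasurableSpace X]

/-- `g = 𝓛 f`, where `𝓛` is the Perron-Frobenius operator of `T` on `L¹(m)`, defined by duality:
`∫ f · φ ∘ T dm = ∫ 𝓛f · φ dm` for all bounded measurable `φ`. -/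
def IsPerronFrobenius (T : X → X) (m : Measure X) (f g : X →₁[m] ℝ) : Prop :=
  ∀ φ : X → ℝ, Measurable φ → (∃ C : ℝ, ∀ x, |φ x| ≤ C) →
    ∫ x, f x * φ (T x) ∂m = ∫ x, g x * φ x ∂m

/-- The transfer operator of the random system with transition density `p`:
`(𝓛_ε f)(x) = ∫ p(z, x) f(z) dm(z)`. -/
def randomTransfer (m : Measure X) (p : X → X → ℝ≥0∞) (f : X →₁[m] ℝ) : X → ℝ :=
  fun x => ∫ z, (p z x).toReal * f z ∂m

end Operators

section Spaces

variable {X : Type*} [TopologicalSpace X] [MeasurableSpace X]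

/-- The conditions on the Banach space `B ⊆ L¹(m)` with seminorm `s`, whose norm is
`f ↦ s f + ‖f‖₁`. -/
structure IsAdaptedSpace (m : Measure X) (B : Submodule ℝ (X →₁[m] ℝ)) (s : Seminorm ℝ B) :
    Prop where
  /-- The constant function `1` belongs to `B`. -/
  one_mem : ∃ f ∈ B, ∀ᵐ x ∂m, f x = 1
  /-- Every element of `B` has a representative whose set of discontinuities is a null set. -/
  ae_continuous : ∀ f ∈ B, ∃ g : X → ℝ, (∀ᵐ x ∂m, f x = g x) ∧ m {x | ¬ ContinuousAt g x} = 0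
  /-- `B` is complete with respect to the norm `s f + ‖f‖₁`. -/
  complete : ∀ u : ℕ → B,
    (∀ δ > 0, ∃ N, ∀ i ≥ N, ∀ j ≥ N, s (u i - u j) + ‖((u i - u j : B) : X →₁[m] ℝ)‖ < δ) →
    ∃ f : B, Tendsto (fun n => s (u n - f) + ‖((u n - f : B) : X →₁[m] ℝ)‖) atTop (𝓝 0)
  /-- The unit ball of `B` is compact in `L¹(m)`. -/
  isCompact_unitBall : IsCompact {f : X →₁[m] ℝ | ∃ h : f ∈ B, s ⟨f, h⟩ + ‖f‖ ≤ 1}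
  /-- `B` is dense in `L¹(m)`. -/
  dense : Dense (B : Set (X →₁[m] ℝ))

end Spaces

section Stationary

variable {X : Type*} [MeasurableSpace X]

/-- `μ` is an absolutely continuous stationary measure (acsm) of the Markov chain with transition
probabilities `P x`: a probability measure with `μ A = ∫ P x A dμ(x)` and `μ ≪ m`. -/
def IsAcsm (P : Kernel X X) (m μ : Measure X) : Prop :=
  IsProbabilityMeasure μ ∧ (∀ A, MeasurableSet A → μ A = ∫⁻ x, P x A ∂μ) ∧ μ ≪ m

/-- A stationary measure is ergodic if every invariant set, that is, every measurable `A` with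
`P x A = 1_A(x)` for `μ`-almost every `x`, has measure `0` or `1`. -/
def IsErgodicStationary (P : Kernel X X) (μ : Measure X) : Prop :=
  ∀ A, MeasurableSet A → (∀ᵐ x ∂μ, P x A = A.indicator (fun _ => (1 : ℝ≥0∞)) x) →
    μ A = 0 ∨ μ A = 1

/-- `μ` is an ergodic absolutely continuous invariant probability measure (acim) of `T`. -/
def IsErgodicAcim (T : X → X) (m μ : Measure X) : Prop :=
  IsProbabilityMeasure μ ∧ Ergodic T μ ∧ μ ≪ m

end Stationary

section PseudoOrbit

variable {X : Type*} [PseudoMetricSpace X]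

/-- `x 0, …, x n` is an `ε`-pseudo-orbit of `T`: each step `x i → x (i + 1)` starts at a
continuity point of `T` and satisfies `d(T (x i), x (i + 1)) < ε`. -/
def IsPseudoOrbit (T : X → X) (ε : ℝ) (n : ℕ) (x : ℕ → X) : Prop :=
  ∀ i < n, ContinuousAt T (x i) ∧ dist (T (x i)) (x (i + 1)) < ε

variable [MeasurableSpace X]

/-- `supp μ → supp ν`: for every `ε > 0` an `ε`-pseudo-orbit leads from `supp μ` to `supp ν`. -/
def Leads (T : X → X) (μ ν : Measure X) : Prop :=
  ∀ ε > 0, ∃ (n : ℕ) (x : ℕ → X), IsPseudoOrbit T ε n x ∧ x 0 ∈ μ.support ∧ x n ∈ ν.support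

/-- `C` is an equivalence class of ergodic acims under `μ ∼ ν ↔ μ → ν ∧ ν → μ`. -/
def IsPseudoOrbitClass (T : X → X) (m : Measure X) (C : Set (Measure X)) : Prop :=
  ∃ μ, IsErgodicAcim T m μ ∧ C = {ν | IsErgodicAcim T m ν ∧ Leads T μ ν ∧ Leads T ν μ}

/-- `C → C'`: every member of `C` leads to every member of `C'`. -/
def ClassLeads (T : X → X) (C C' : Set (Measure X)) : Prop :=
  ∀ μ ∈ C, ∀ ν ∈ C', Leads T μ ν

/-- The class `C` is a least element: it leads to no other class. -/
def IsLeastElement (T : X → X) (m : Measure X) (C : Set (Measure X)) : Prop :=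
  ∀ C', IsPseudoOrbitClass T m C' → C' ≠ C → ¬ ClassLeads T C C'

/-- The subset of phase space given by a class: the union of the supports of its members. -/
def classCarrier (C : Set (Measure X)) : Set X :=
  ⋃ μ ∈ C, μ.support

end PseudoOrbit

end

end PseudoOrbits

/-!
The map `T` is treated as the deterministic Markov kernel `x ↦ δ_{T x}`, so that acims of `T` and
acsms of `P ε` are instances of the same notion: probability measures whose density is a fixed point
of the transfer operator of a Markov kernel. The operator enters only as a relation `IsTransfer`,
defined by duality.

*Functional analysis.* If `h` is a fixed density, approximate it in `L¹` by `f ∈ B`. The iterates of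
`f` stay as close to `h` as `f` is, and by the Lasota-Yorke inequality they end up in a ball of `B`
whose radius depends only on `η` and `D`. Balls of `B` are compact in `L¹`, so `h` lies in that ball
(`LasotaYorke.mem_strongBall`). Hence all densities of acims and acsms lie in one compact subset of
`L¹`, which has four consequences: each acsm dominates an ergodic one (`IsAcsm.exists_ergodic`);
Cesàro averages produce acsms in absorbing sets (`LasotaYorke.exists_isAcsm`); limits of acsms as
`ε → 0` exist along subsequences in the sense of densities and are `T`-invariant
(`measurePreserving_of_tendsto`); and every density is almost everywhere continuous, so that the
measure is equivalent to `m` on an open set of full measure (`IsOpenCarrier`).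

*Pseudo-orbits.* Call `A` pseudo-invariant if it contains the `ε`-ball around `T x` for every
continuity point `x ∈ A`. The support of an acsm of `P ε` is pseudo-invariant, and so is the set
`reach T ε S` of endpoints of `ε`-pseudo-orbits from `S`. By ergodicity, a pseudo-invariant set
charged by an ergodic acim `μ` contains the `ε`-neighbourhood of its support; therefore it contains
the support of every `ν` with `μ → ν` (`Leads.measure_ne_zero`).

*Least classes.* `U` is the set reached from the support of a member `μ₁` of the class. For small
`ε`, an acsm on `U` has a support which contains that of `μ₁`: otherwise a limit of acsms which
violate this would have an ergodic component that is reached from `μ₁` and does not lead back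
(`PerturbedSystem.exists_support_subset`). Distinct ergodic acsms have disjoint open carriers, which
rules out two of them with this property.

*Other classes.* Let `μ₁ → ν₁` without return. An acsm which charges the class of `μ₁` can be
restricted to the complement of the absorbing set reached from `ν₁`. The restriction is stationary
and still charges `μ₁`, which forces it to charge the set reached from `ν₁`, a contradiction
(`PerturbedSystem.inter_support_eq_empty`). Convergence of densities in `L¹` carries this over to
weak limits.
-/

namespace PseudoOrbits

/-! ### The transfer operator of a Markov kernel -/

section Transfer

lemma abs_indicator_one_le {X : Type*} (A : Set X) (x : X) : |A.indicator (1 : X → ℝ) x| ≤ 1 := by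
  by_cases h : x ∈ A <;> simp [h]

variable {X : Type*} [MeasurableSpace X]

/-- `g` is the image of `f` under the transfer operator on `L¹(m)` of the Markov kernel `P`, defined
by duality: `∫ f · Pφ dm = ∫ g · φ dm` for all bounded measurable `φ`, where
`Pφ(x) = ∫ φ dP(x, ·)`. It is a relation, since the image of the measure `f · m` under `P` need not
be absolutely continuous. -/
def IsTransfer (P : Kernel X X) (m : Measure X) (f g : X →₁[m] ℝ) : Prop :=
  ∀ φ : X → ℝ, Measurable φ → (∃ C : ℝ, ∀ x, |φ x| ≤ C) →
    ∫ x, f x * (∫ y, φ y ∂P x) ∂m = ∫ x, g x * φ x ∂m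

/-- `h ∈ L¹(m)` is a nonnegative density of `μ` with respect to `m`. -/
structure IsDensity (m μ : Measure X) (h : X →₁[m] ℝ) : Prop where
  nonneg : ∀ᵐ x ∂m, 0 ≤ h x
  eq_withDensity : μ = m.withDensity fun x => ENNReal.ofReal (h x)

variable {m μ : Measure X} {P : Kernel X X}

lemma integrable_mul_of_bdd (f : X →₁[m] ℝ) {φ : X → ℝ} (hφ : Measurable φ) {C : ℝ}
    (hC : ∀ x, |φ x| ≤ C) : Integrable (fun x => f x * φ x) m :=
  (L1.integrable_coeFn f).mul_bdd (c := C) hφ.aestronglyMeasurable (.of_forall hC)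

lemma integral_sub_mul (f g : X →₁[m] ℝ) {φ : X → ℝ} (hφ : Measurable φ) {C : ℝ}
    (hC : ∀ x, |φ x| ≤ C) :
    ∫ x, (f - g : X →₁[m] ℝ) x * φ x ∂m = ∫ x, f x * φ x ∂m - ∫ x, g x * φ x ∂m := by
  rw [← integral_sub (integrable_mul_of_bdd f hφ hC) (integrable_mul_of_bdd g hφ hC)]
  refine integral_congr_ae ?_
  filter_upwards [Lp.coeFn_sub f g] with x hx
  rw [hx, Pi.sub_apply, sub_mul]

lemma integral_add_mul (f g : X →₁[m] ℝ) {φ : X → ℝ} (hφ : Measurable φ) {C : ℝ}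
    (hC : ∀ x, |φ x| ≤ C) :
    ∫ x, (f + g : X →₁[m] ℝ) x * φ x ∂m = ∫ x, f x * φ x ∂m + ∫ x, g x * φ x ∂m := by
  rw [← integral_add (integrable_mul_of_bdd f hφ hC) (integrable_mul_of_bdd g hφ hC)]
  refine integral_congr_ae ?_
  filter_upwards [Lp.coeFn_add f g] with x hx
  rw [hx, Pi.add_apply, add_mul]

lemma integral_smul_mul (c : ℝ) (f : X →₁[m] ℝ) (φ : X → ℝ) :
    ∫ x, (c • f : X →₁[m] ℝ) x * φ x ∂m = c * ∫ x, f x * φ x ∂m := by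
  rw [← integral_const_mul]
  refine integral_congr_ae ?_
  filter_upwards [Lp.coeFn_smul c f] with x hx
  rw [hx, Pi.smul_apply, smul_eq_mul, mul_assoc]

lemma abs_integral_mul_le (f : X →₁[m] ℝ) {φ : X → ℝ} (hφ : Measurable φ) {C : ℝ}
    (hC : ∀ x, |φ x| ≤ C) : |∫ x, f x * φ x ∂m| ≤ C * ‖f‖ := by
  rw [L1.norm_eq_integral_norm, ← integral_const_mul]
  refine (abs_integral_le_integral_abs).trans (integral_mono
    (integrable_mul_of_bdd f hφ hC).abs ((L1.integrable_coeFn f).norm.const_mul C) fun x => ?_)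
  simp only [abs_mul, Real.norm_eq_abs]
  rw [mul_comm]
  exact mul_le_mul_of_nonneg_right (hC x) (abs_nonneg _)

lemma tendsto_integral_mul {ι : Type*} {l : Filter ι} {u : ι → X →₁[m] ℝ} {f : X →₁[m] ℝ}
    (hu : Tendsto u l (𝓝 f)) {φ : X → ℝ} (hφ : Measurable φ) (hC : ∃ C : ℝ, ∀ x, |φ x| ≤ C) :
    Tendsto (fun i => ∫ x, u i x * φ x ∂m) l (𝓝 (∫ x, f x * φ x ∂m)) := by
  obtain ⟨C, hC⟩ := hC
  rw [tendsto_iff_norm_sub_tendsto_zero] at hu ⊢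
  refine squeeze_zero (fun _ => norm_nonneg _) (fun i => ?_) (by simpa using hu.const_mul C)
  rw [← integral_sub_mul _ _ hφ hC]
  exact abs_integral_mul_le _ hφ hC

/-- Pairing with the sign of `f` recovers the norm of `f`. -/
lemma exists_integral_mul_eq_norm (f : X →₁[m] ℝ) :
    ∃ φ : X → ℝ, Measurable φ ∧ (∀ x, |φ x| ≤ 1) ∧ ∫ x, f x * φ x ∂m = ‖f‖ := by
  have hf : Measurable f := (Lp.stronglyMeasurable f).measurable
  refine ⟨fun x => if 0 ≤ f x then 1 else -1, Measurable.ite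
    (measurableSet_le measurable_const hf) measurable_const measurable_const, fun x => ?_, ?_⟩
  · dsimp only
    split_ifs <;> simp
  · rw [L1.norm_eq_integral_norm]
    refine integral_congr_ae (.of_forall fun x => ?_)
    dsimp only
    split_ifs with h
    · simp [abs_of_nonneg h]
    · simp [abs_of_neg (not_le.1 h)]

lemma measurable_kernel_integral {φ : X → ℝ} (hφ : Measurable φ) :
    Measurable fun x => ∫ y, φ y ∂P x :=
  (hφ.stronglyMeasurable.integral_kernel (κ := P)).measurable

lemma abs_kernel_integral_le [IsMarkovKernel P] {φ : X → ℝ} {C : ℝ} (hC : ∀ x, |φ x| ≤ C) (x : X) :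
    |∫ y, φ y ∂P x| ≤ C := by
  simpa using norm_integral_le_of_norm_le_const (μ := P x) (f := φ) (C := C) (.of_forall hC)

lemma kernel_integral_indicator {A : Set X} (hA : MeasurableSet A) (x : X) :
    ∫ y, A.indicator 1 y ∂P x = (P x).real A := by
  rw [integral_indicator_one hA]

lemma measurable_indicator_one {A : Set X} (hA : MeasurableSet A) :
    Measurable (A.indicator (1 : X → ℝ)) :=
  measurable_one.indicator hA

lemma integral_mul_indicator {A : Set X} (hA : MeasurableSet A) (f : X → ℝ) :
    ∫ x, f x * A.indicator 1 x ∂m = ∫ x in A, f x ∂m := by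
  rw [← integral_indicator hA]
  congr 1 with x
  by_cases h : x ∈ A <;> simp [h]

namespace IsTransfer

variable {f g f' g' : X →₁[m] ℝ}

lemma smul (c : ℝ) (h : IsTransfer P m f g) : IsTransfer P m (c • f) (c • g) := by
  rintro φ hφ hC
  rw [integral_smul_mul, integral_smul_mul, h φ hφ hC]

lemma zero : IsTransfer P m (0 : X →₁[m] ℝ) 0 := by
  intro φ hφ hC
  have h := integral_smul_mul (m := m) 0 0
  simp only [zero_smul, zero_mul] at h
  rw [h, h]

lemma setIntegral_eq (h : IsTransfer P m f g) {A : Set X} (hA : MeasurableSet A) :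
    ∫ x, f x * (P x).real A ∂m = ∫ x in A, g x ∂m := by
  rw [← integral_mul_indicator hA, ← h _ (measurable_indicator_one hA) ⟨1, abs_indicator_one_le A⟩]
  simp only [kernel_integral_indicator hA]

lemma nonneg (h : IsTransfer P m f g) (hf : ∀ᵐ x ∂m, 0 ≤ f x) : ∀ᵐ x ∂m, 0 ≤ g x := by
  refine ae_nonneg_of_forall_setIntegral_nonneg (L1.integrable_coeFn g) fun A hA _ => ?_
  rw [← h.setIntegral_eq hA]
  refine integral_nonneg_of_ae ?_
  filter_upwards [hf] with x hx using mul_nonneg hx measureReal_nonneg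

/-- Mass carried by an absorbing set stays in it. -/
lemma eq_zero_compl (h : IsTransfer P m f g) {U : Set X} (hU : MeasurableSet U)
    (hPU : ∀ᵐ x ∂m, x ∈ U → P x Uᶜ = 0) (hf : ∀ᵐ x ∂m, 0 ≤ f x) (hfU : ∀ᵐ x ∂m, x ∉ U → f x = 0) :
    ∀ᵐ x ∂m, x ∉ U → g x = 0 := by
  have h1 : ∫ x in Uᶜ, g x ∂m = 0 := by
    rw [← h.setIntegral_eq hU.compl]
    refine integral_eq_zero_of_ae ?_
    filter_upwards [hPU, hfU] with x hx hx'
    by_cases hxU : x ∈ U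
    · simp [Measure.real, hx hxU]
    · simp [hx' hxU]
  rw [setIntegral_eq_zero_iff_of_nonneg_ae (ae_restrict_of_ae (h.nonneg hf))
    (L1.integrable_coeFn g).integrableOn] at h1
  exact (ae_restrict_iff' hU.compl).1 h1

variable [IsMarkovKernel P]

lemma add (h : IsTransfer P m f g) (h' : IsTransfer P m f' g') :
    IsTransfer P m (f + f') (g + g') := by
  rintro φ hφ ⟨C, hC⟩
  rw [integral_add_mul _ _ hφ hC, integral_add_mul _ _ (measurable_kernel_integral hφ)
    (abs_kernel_integral_le hC), h φ hφ ⟨C, hC⟩, h' φ hφ ⟨C, hC⟩]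

lemma sub (h : IsTransfer P m f g) (h' : IsTransfer P m f' g') :
    IsTransfer P m (f - f') (g - g') := by
  rintro φ hφ ⟨C, hC⟩
  rw [integral_sub_mul _ _ hφ hC, integral_sub_mul _ _ (measurable_kernel_integral hφ)
    (abs_kernel_integral_le hC), h φ hφ ⟨C, hC⟩, h' φ hφ ⟨C, hC⟩]

lemma sum {ι : Type*} (t : Finset ι) {u v : ι → X →₁[m] ℝ}
    (h : ∀ i ∈ t, IsTransfer P m (u i) (v i)) :
    IsTransfer P m (∑ i ∈ t, u i) (∑ i ∈ t, v i) := by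
  classical
  induction t using Finset.induction_on with
  | empty => simpa using zero
  | insert a t ha ih =>
    rw [Finset.sum_insert ha, Finset.sum_insert ha]
    exact (h a (by simp)).add (ih fun i hi => h i (by simp [hi]))

lemma norm_le (h : IsTransfer P m f g) : ‖g‖ ≤ ‖f‖ := by
  obtain ⟨φ, hφ, hC, hn⟩ := exists_integral_mul_eq_norm g
  rw [← hn, ← h φ hφ ⟨1, hC⟩, ← one_mul ‖f‖]
  exact (le_abs_self _).trans (abs_integral_mul_le f (measurable_kernel_integral hφ)
    (abs_kernel_integral_le hC))

/-- The graph of the transfer operator is closed. -/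
lemma of_tendsto {ι : Type*} {l : Filter ι} [l.NeBot] {u v : ι → X →₁[m] ℝ}
    (hu : Tendsto u l (𝓝 f)) (hv : Tendsto v l (𝓝 g)) (h : ∀ i, IsTransfer P m (u i) (v i)) :
    IsTransfer P m f g := by
  rintro φ hφ ⟨C, hC⟩
  refine tendsto_nhds_unique (tendsto_integral_mul hu (measurable_kernel_integral hφ)
    ⟨C, abs_kernel_integral_le hC⟩) ?_
  refine (tendsto_integral_mul hv hφ ⟨C, hC⟩).congr fun i => ?_
  exact (h i φ hφ ⟨C, hC⟩).symm

lemma integral_eq (h : IsTransfer P m f g) : ∫ x, f x ∂m = ∫ x, g x ∂m := by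
  simpa using h 1 measurable_one ⟨1, fun x => by simp⟩

end IsTransfer

lemma exists_isDensity [SigmaFinite m] [IsFiniteMeasure μ] (h : μ ≪ m) :
    ∃ f : X →₁[m] ℝ, IsDensity m μ f := by
  have hi : Integrable (fun x => (μ.rnDeriv m x).toReal) m := Measure.integrable_toReal_rnDeriv
  refine ⟨hi.toL1 _, ?_, ?_⟩
  · filter_upwards [hi.coeFn_toL1] with x hx
    rw [hx]
    exact ENNReal.toReal_nonneg
  · refine (Measure.withDensity_rnDeriv_eq μ m h).symm.trans (withDensity_congr_ae ?_)
    filter_upwards [hi.coeFn_toL1, Measure.rnDeriv_lt_top μ m] with x hx hx'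
    rw [hx, ENNReal.ofReal_toReal hx'.ne]

namespace IsDensity

variable {h : X →₁[m] ℝ}

lemma integral_eq (hμ : IsDensity m μ h) (φ : X → ℝ) :
    ∫ x, φ x ∂μ = ∫ x, h x * φ x ∂m := by
  have hm : Measurable fun x => ENNReal.ofReal (h x) :=
    (Lp.stronglyMeasurable h).measurable.ennreal_ofReal
  rw [hμ.eq_withDensity, integral_withDensity_eq_integral_toReal_smul hm
    (.of_forall fun _ => ENNReal.ofReal_lt_top)]
  refine integral_congr_ae ?_
  filter_upwards [hμ.nonneg] with x hx
  rw [ENNReal.toReal_ofReal hx, smul_eq_mul]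

lemma real_apply (hμ : IsDensity m μ h) {A : Set X} (hA : MeasurableSet A) :
    μ.real A = ∫ x in A, h x ∂m := by
  rw [← integral_indicator_one hA, hμ.integral_eq, integral_mul_indicator hA]

lemma absolutelyContinuous (hμ : IsDensity m μ h) : μ ≪ m :=
  hμ.eq_withDensity ▸ withDensity_absolutelyContinuous _ _

lemma norm_eq (hμ : IsDensity m μ h) : ‖h‖ = ∫ x, h x ∂m := by
  rw [L1.norm_eq_integral_norm]
  refine integral_congr_ae ?_
  filter_upwards [hμ.nonneg] with x hx using Real.norm_of_nonneg hx

lemma norm_eq_one [IsProbabilityMeasure μ] (hμ : IsDensity m μ h) : ‖h‖ = 1 := by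
  rw [hμ.norm_eq, ← setIntegral_univ, ← hμ.real_apply .univ, probReal_univ]

lemma apply_eq_zero_iff (hμ : IsDensity m μ h) {A : Set X} (hA : MeasurableSet A) :
    μ A = 0 ↔ ∀ᵐ x ∂m, x ∈ A → h x = 0 := by
  have hm : Measurable fun x => ENNReal.ofReal (h x) :=
    (Lp.stronglyMeasurable h).measurable.ennreal_ofReal
  rw [hμ.eq_withDensity, withDensity_apply _ hA, lintegral_eq_zero_iff hm,
    EventuallyEq, ae_restrict_iff' hA]
  refine eventually_congr ?_
  filter_upwards [hμ.nonneg] with x hx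
  simp only [Pi.zero_apply, ENNReal.ofReal_eq_zero]
  exact imp_congr_right fun _ => ⟨fun h => le_antisymm h hx, fun h => h.le⟩

end IsDensity

lemma exists_probabilityMeasure_of_density {h : X →₁[m] ℝ} (h0 : ∀ᵐ x ∂m, 0 ≤ h x)
    (h1 : ∫ x, h x ∂m = 1) : ∃ μ : Measure X, IsProbabilityMeasure μ ∧ IsDensity m μ h := by
  refine ⟨_, ⟨?_⟩, h0, rfl⟩
  rw [withDensity_apply _ .univ, Measure.restrict_univ,
    ← ofReal_integral_eq_lintegral_ofReal (L1.integrable_coeFn h) h0, h1, ENNReal.ofReal_one]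

lemma integral_kernel_of_stationary [IsMarkovKernel P] [IsFiniteMeasure μ]
    (hμ : ∀ A, MeasurableSet A → μ A = ∫⁻ x, P x A ∂μ) {φ : X → ℝ} (hφ : Measurable φ)
    (hC : ∃ C, ∀ x, |φ x| ≤ C) : ∫ x, ∫ y, φ y ∂P x ∂μ = ∫ x, φ x ∂μ := by
  have hb : μ.bind P = μ := by
    ext A hA
    rw [Measure.bind_apply hA P.measurable.aemeasurable, ← hμ A hA]
  obtain ⟨C, hC⟩ := hC
  have hi : Integrable φ (μ.bind P) := by
    rw [hb]
    exact Integrable.of_bound hφ.aestronglyMeasurable C (.of_forall hC)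
  have hc : (P ∘ₖ Kernel.const Unit μ) () = P ∘ₘ μ := by
    rw [Kernel.comp_apply, Kernel.const_apply]
  rw [← hc] at hi
  have := Kernel.integral_comp hi
  rw [hc, hb, Kernel.const_apply] at this
  exact this.symm

/-- A probability measure with density `h` is an acsm iff `h` is a fixed point of the transfer
operator. -/
lemma IsDensity.isAcsm_iff [IsMarkovKernel P] [IsProbabilityMeasure μ] {h : X →₁[m] ℝ}
    (hμ : IsDensity m μ h) : IsAcsm P m μ ↔ IsTransfer P m h h := by
  constructor
  · rintro ⟨-, hs, -⟩ φ hφ hC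
    rw [← hμ.integral_eq, ← hμ.integral_eq, integral_kernel_of_stationary hs hφ hC]
  · intro ht
    refine ⟨inferInstance, fun A hA => ?_, hμ.absolutelyContinuous⟩
    have h1 := ht.setIntegral_eq hA
    rw [← hμ.real_apply hA, ← hμ.integral_eq] at h1
    have h2 : ∫ x, (P x).real A ∂μ = (∫⁻ x, P x A ∂μ).toReal :=
      integral_toReal (P.measurable_coe hA).aemeasurable (.of_forall fun x => measure_lt_top _ _)
    rw [h2] at h1
    refine ((ENNReal.toReal_eq_toReal_iff' ?_ (measure_ne_top _ _)).1 h1).symm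
    refine ((lintegral_mono fun x => prob_le_one).trans_lt (b := ∫⁻ _, 1 ∂μ) ?_).ne
    simp

end Transfer

/-! ### Lasota-Yorke inequalities -/

section LasotaYorke

variable {X : Type*} [MeasurableSpace X]

/-- The ball of radius `R` of the norm `s f + ‖f‖₁` on `B`, as a subset of `L¹(m)`. -/
def strongBall {m : Measure X} {B : Submodule ℝ (X →₁[m] ℝ)} (s : Seminorm ℝ B) (R : ℝ) :
    Set (X →₁[m] ℝ) :=
  {f | ∃ h : f ∈ B, s ⟨f, h⟩ + ‖f‖ ≤ R}

/-- The transfer operator of `P` maps `B` into itself and satisfies a Lasota-Yorke inequality. -/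
def LasotaYorke (P : Kernel X X) {m : Measure X} {B : Submodule ℝ (X →₁[m] ℝ)}
    (s : Seminorm ℝ B) (η D : ℝ) : Prop :=
  ∀ f : B, ∃ g : B, IsTransfer P m f g ∧ s g ≤ η * s f + D * ‖(f : X →₁[m] ℝ)‖

variable {m μ : Measure X} {P : Kernel X X} {B : Submodule ℝ (X →₁[m] ℝ)} {s : Seminorm ℝ B}

lemma isCompact_strongBall (h : IsCompact (strongBall s 1)) {R : ℝ} (hR : 0 < R) :
    IsCompact (strongBall s R) := by
  have : strongBall s R ⊆ (fun f => R • f) '' strongBall s 1 := by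
    rintro f ⟨hf, hfR⟩
    refine ⟨R⁻¹ • f, ⟨B.smul_mem _ hf, ?_⟩, smul_inv_smul₀ hR.ne' f⟩
    have h1 : s ⟨R⁻¹ • f, B.smul_mem _ hf⟩ = R⁻¹ * s ⟨f, hf⟩ := by
      have := map_smul_eq_mul s R⁻¹ ⟨f, hf⟩
      rwa [Real.norm_of_nonneg (inv_nonneg.2 hR.le)] at this
    rw [h1, norm_smul, Real.norm_of_nonneg (inv_nonneg.2 hR.le), ← mul_add]
    calc R⁻¹ * (s ⟨f, hf⟩ + ‖f‖) ≤ R⁻¹ * R := by gcongr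
      _ = 1 := inv_mul_cancel₀ hR.ne'
  have hsub : (fun f => R • f) '' strongBall s 1 ⊆ strongBall s R := by
    rintro _ ⟨f, ⟨hf, hf1⟩, rfl⟩
    refine ⟨B.smul_mem _ hf, ?_⟩
    have h1 : s ⟨R • f, B.smul_mem _ hf⟩ = R * s ⟨f, hf⟩ := by
      have := map_smul_eq_mul s R ⟨f, hf⟩
      rwa [Real.norm_of_nonneg hR.le] at this
    dsimp only
    rw [h1, norm_smul, Real.norm_of_nonneg hR.le, ← mul_add]
    nlinarith
  rw [this.antisymm hsub]
  exact h.image (continuous_const_smul R)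

/-- Iterating the Lasota-Yorke inequality. -/
lemma LasotaYorke.exists_orbit [IsMarkovKernel P] {η D : ℝ} (hLY : LasotaYorke P s η D)
    (hη₀ : 0 ≤ η) (hη₁ : η < 1) (hD : 0 ≤ D) (f : B) :
    ∃ u : ℕ → B, u 0 = f ∧ (∀ n, IsTransfer P m (u n) (u (n + 1))) ∧
      (∀ n, ‖(u n : X →₁[m] ℝ)‖ ≤ ‖(f : X →₁[m] ℝ)‖) ∧
      ∀ n, s (u n) ≤ η ^ n * s f + D / (1 - η) * ‖(f : X →₁[m] ℝ)‖ := by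
  choose L hL hLs using hLY
  have hu : ∀ n, IsTransfer P m (L^[n] f : B) (L^[n + 1] f : B) := fun n => by
    rw [Function.iterate_succ_apply']
    exact hL _
  have hn : ∀ n, ‖(L^[n] f : X →₁[m] ℝ)‖ ≤ ‖(f : X →₁[m] ℝ)‖ := by
    intro n
    induction n with
    | zero => simp
    | succ n ih => exact (hu n).norm_le.trans ih
  refine ⟨fun n => L^[n] f, rfl, hu, hn, fun n => ?_⟩
  have h1 : 0 < 1 - η := by linarith
  induction n with
  | zero => simpa using by positivity
  | succ n ih =>
    simp only [Function.iterate_succ_apply'] at ih ⊢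
    calc s (L (L^[n] f)) ≤ η * s (L^[n] f) + D * ‖(L^[n] f : X →₁[m] ℝ)‖ := hLs _
      _ ≤ η * (η ^ n * s f + D / (1 - η) * ‖(f : X →₁[m] ℝ)‖) + D * ‖(f : X →₁[m] ℝ)‖ := by
        gcongr
        exact hn n
      _ = η ^ (n + 1) * s f + D / (1 - η) * ‖(f : X →₁[m] ℝ)‖ := by
        field_simp
        ring

/-- Invariant densities lie in `B`, with a bound that depends only on the Lasota-Yorke constants.
An invariant `h` is approximated by `f ∈ B`; the iterates of `f` are no farther from `h`, and they
are eventually bounded in the norm of `B` independently of `f`. -/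
lemma LasotaYorke.mem_strongBall [IsMarkovKernel P] {η D : ℝ} (hLY : LasotaYorke P s η D)
    (hη₀ : 0 ≤ η) (hη₁ : η < 1) (hD : 0 ≤ D) (hc : IsCompact (strongBall s 1))
    (hd : Dense (B : Set (X →₁[m] ℝ))) {h : X →₁[m] ℝ} (hh : IsTransfer P m h h) (h1 : ‖h‖ = 1) :
    h ∈ strongBall s (2 * (D / (1 - η)) + 3) := by
  have hK : 0 ≤ D / (1 - η) := div_nonneg hD (by linarith)
  have hcl : IsClosed (strongBall s (2 * (D / (1 - η)) + 3)) :=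
    (isCompact_strongBall hc (by linarith)).isClosed
  rw [← hcl.closure_eq, Metric.mem_closure_iff]
  intro ε hε
  obtain ⟨f, hf, hfh⟩ := hd.exists_dist_lt h (lt_min hε one_pos)
  obtain ⟨u, hu0, hu, hun, hus⟩ := hLY.exists_orbit hη₀ hη₁ hD ⟨f, hf⟩
  -- contraction in `L¹` keeps the iterates near the fixed point `h`, and `‖f‖ ≤ 2`
  have hlim : Tendsto (fun n => η ^ n * s ⟨f, hf⟩) atTop (𝓝 0) := by
    simpa using (tendsto_pow_atTop_nhds_zero_of_lt_one hη₀ hη₁).mul_const (s ⟨f, hf⟩)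
  obtain ⟨n, hn⟩ := (hlim.eventually_lt_const one_pos).exists
  have hdist : ∀ n, ‖h - u n‖ ≤ ‖h - f‖ := by
    intro n
    induction n with
    | zero => simp [hu0]
    | succ n ih => exact (hh.sub (hu n)).norm_le.trans ih
  rw [dist_eq_norm, lt_min_iff] at hfh
  refine ⟨u n, ⟨(u n).2, ?_⟩, by rw [dist_eq_norm]; exact (hdist n).trans_lt hfh.1⟩
  have hf2 : ‖f‖ ≤ 2 := by
    have := norm_sub_norm_le f h
    rw [norm_sub_rev] at this
    linarith
  have h3 := hus n
  have h4 := hun n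
  have h5 : D / (1 - η) * ‖f‖ ≤ D / (1 - η) * 2 := by gcongr
  dsimp only at h3 h4
  change s (u n) + _ ≤ _
  linarith

lemma integral_sum_mul {ι : Type*} (t : Finset ι) (u : ι → X →₁[m] ℝ) {φ : X → ℝ}
    (hφ : Measurable φ) {C : ℝ} (hC : ∀ x, |φ x| ≤ C) :
    ∫ x, (∑ i ∈ t, u i : X →₁[m] ℝ) x * φ x ∂m = ∑ i ∈ t, ∫ x, u i x * φ x ∂m := by
  classical
  induction t using Finset.induction_on with
  | empty => simpa using integral_smul_mul (m := m) 0 0 φ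
  | insert a t ha ih =>
    rw [Finset.sum_insert ha, Finset.sum_insert ha, integral_add_mul _ _ hφ hC, ih]

/-- Cesàro averages of the iterates of a density in `B` supported in an absorbing set `U` converge,
along a subsequence, to the density of an acsm supported in `U`. -/
lemma LasotaYorke.exists_isAcsm [IsMarkovKernel P] {η D : ℝ} (hLY : LasotaYorke P s η D)
    (hη₀ : 0 ≤ η) (hη₁ : η < 1) (hD : 0 ≤ D) (hc : IsCompact (strongBall s 1))
    {U : Set X} (hU : MeasurableSet U) (hPU : ∀ᵐ x ∂m, x ∈ U → P x Uᶜ = 0)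
    (f : B) (hf0 : ∀ᵐ x ∂m, 0 ≤ (f : X →₁[m] ℝ) x) (hf1 : ∫ x, (f : X →₁[m] ℝ) x ∂m = 1)
    (hfU : ∀ᵐ x ∂m, x ∉ U → (f : X →₁[m] ℝ) x = 0) :
    ∃ μ, IsAcsm P m μ ∧ μ Uᶜ = 0 := by
  have hK : 0 ≤ D / (1 - η) := div_nonneg hD (by linarith)
  obtain ⟨u, hu0, hu, hun, hus⟩ := hLY.exists_orbit hη₀ hη₁ hD f
  have hpos : ∀ n, ∀ᵐ x ∂m, 0 ≤ (u n : X →₁[m] ℝ) x := by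
    intro n
    induction n with
    | zero => rwa [hu0]
    | succ n ih => exact (hu n).nonneg ih
  have hint : ∀ n, ∫ x, (u n : X →₁[m] ℝ) x ∂m = 1 := by
    intro n
    induction n with
    | zero => rwa [hu0]
    | succ n ih => rw [← (hu n).integral_eq, ih]
  have hsupp : ∀ n, ∀ᵐ x ∂m, x ∉ U → (u n : X →₁[m] ℝ) x = 0 := by
    intro n
    induction n with
    | zero => rwa [hu0]
    | succ n ih => exact (hu n).eq_zero_compl hU hPU (hpos n) ih
  set a : ℕ → B := fun n => ((n : ℝ) + 1)⁻¹ • ∑ k ∈ Finset.range (n + 1), u k with ha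
  set a' : ℕ → X →₁[m] ℝ := fun n =>
    ((n : ℝ) + 1)⁻¹ • ∑ k ∈ Finset.range (n + 1), (u (k + 1) : X →₁[m] ℝ) with ha'
  have hacoe : ∀ n, (a n : X →₁[m] ℝ) =
      ((n : ℝ) + 1)⁻¹ • ∑ k ∈ Finset.range (n + 1), (u k : X →₁[m] ℝ) := fun n => by
    simp [ha]
  have hfn : ‖(f : X →₁[m] ℝ)‖ = 1 := by
    rw [L1.norm_eq_integral_norm, ← hf1]
    refine integral_congr_ae ?_
    filter_upwards [hf0] with x hx using Real.norm_of_nonneg hx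
  have hball : ∀ n, (a n : X →₁[m] ℝ) ∈ strongBall s (s f + D / (1 - η) + 1) := by
    intro n
    have hn : (0 : ℝ) < (n : ℝ) + 1 := by positivity
    refine ⟨(a n).2, ?_⟩
    have e1 : s (a n) ≤ s f + D / (1 - η) := by
      rw [ha]
      dsimp only
      rw [map_smul_eq_mul, Real.norm_of_nonneg (by positivity), inv_mul_le_iff₀ hn]
      refine (Finset.le_sum_of_subadditive s (map_zero s).le (map_add_le_add s) _ _).trans ?_
      calc ∑ k ∈ Finset.range (n + 1), s (u k)
          ≤ ∑ k ∈ Finset.range (n + 1), (s f + D / (1 - η)) := by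
            refine Finset.sum_le_sum fun k _ => (hus k).trans ?_
            rw [hfn, mul_one]
            gcongr
            exact mul_le_of_le_one_left (apply_nonneg s f) (pow_le_one₀ hη₀ hη₁.le)
        _ = _ := by simp [mul_add]
    have e2 : ‖(a n : X →₁[m] ℝ)‖ ≤ 1 := by
      rw [hacoe, norm_smul, Real.norm_of_nonneg (by positivity), inv_mul_le_iff₀ hn]
      refine (norm_sum_le _ _).trans ?_
      calc ∑ k ∈ Finset.range (n + 1), ‖(u k : X →₁[m] ℝ)‖
          ≤ ∑ k ∈ Finset.range (n + 1), 1 :=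
            Finset.sum_le_sum fun k _ => (hun k).trans hfn.le
        _ = _ := by simp
    exact add_le_add e1 e2
  obtain ⟨h, -, ψ, hψ, hlim⟩ := (isCompact_strongBall hc
    (by have := apply_nonneg s f; linarith)).tendsto_subseq hball
  have htr : ∀ n, IsTransfer P m (a n) (a' n) := fun n => by
    rw [hacoe]
    exact (IsTransfer.sum _ fun k _ => hu k).smul _
  have hsub : ∀ n, a' n - a n = ((n : ℝ) + 1)⁻¹ • ((u (n + 1) : X →₁[m] ℝ) - u 0) := fun n => by
    rw [hacoe, ha', ← smul_sub, ← Finset.sum_sub_distrib,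
      Finset.sum_range_sub (fun k => (u k : X →₁[m] ℝ))]
  -- `a' n` is the image of the average `a n`; the two differ by a telescoping sum
  have hdiff : Tendsto (fun n => a' n - a n) atTop (𝓝 0) := by
    rw [tendsto_zero_iff_norm_tendsto_zero]
    refine squeeze_zero (g := fun n : ℕ => 2 * (1 / ((n : ℝ) + 1))) (fun _ => norm_nonneg _)
      (fun n => ?_) (by simpa using tendsto_one_div_add_atTop_nhds_zero_nat.const_mul (2 : ℝ))
    rw [hsub, norm_smul, Real.norm_of_nonneg (by positivity), one_div, mul_comm]
    gcongr
    calc ‖(u (n + 1) : X →₁[m] ℝ) - u 0‖ ≤ ‖(u (n + 1) : X →₁[m] ℝ)‖ + ‖(u 0 : X →₁[m] ℝ)‖ :=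
          norm_sub_le _ _
      _ ≤ 1 + 1 := add_le_add ((hun _).trans hfn.le) ((hun _).trans hfn.le)
      _ = 2 := by norm_num
  have hlim' : Tendsto (a' ∘ ψ) atTop (𝓝 h) := by
    have := (hdiff.comp hψ.tendsto_atTop).add hlim
    simpa [Function.comp_def] using this
  have hh : IsTransfer P m h h := IsTransfer.of_tendsto hlim hlim' fun i => htr _
  have hpair : ∀ A, MeasurableSet A → Tendsto (fun i => ∫ x in A, (a (ψ i) : X →₁[m] ℝ) x ∂m) atTop
      (𝓝 (∫ x in A, h x ∂m)) := fun A hA => by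
    have := tendsto_integral_mul hlim (measurable_indicator_one hA) ⟨1, abs_indicator_one_le A⟩
    simpa only [integral_mul_indicator hA, Function.comp_def] using this
  have hav : ∀ A, MeasurableSet A → ∀ n, ∫ x in A, (a n : X →₁[m] ℝ) x ∂m =
      ((n : ℝ) + 1)⁻¹ * ∑ k ∈ Finset.range (n + 1), ∫ x in A, (u k : X →₁[m] ℝ) x ∂m := by
    intro A hA n
    rw [← integral_mul_indicator hA, hacoe, integral_smul_mul,
      integral_sum_mul _ _ (measurable_indicator_one hA) (abs_indicator_one_le A)]
    simp only [integral_mul_indicator hA]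
  have h0 : ∀ᵐ x ∂m, 0 ≤ h x := by
    refine ae_nonneg_of_forall_setIntegral_nonneg (L1.integrable_coeFn h) fun A hA _ => ?_
    refine ge_of_tendsto' (hpair A hA) fun n => ?_
    rw [hav A hA]
    exact mul_nonneg (by positivity) (Finset.sum_nonneg fun k _ =>
      setIntegral_nonneg_of_ae (hpos k))
  have h1 : ∫ x, h x ∂m = 1 := by
    rw [← setIntegral_univ]
    refine tendsto_nhds_unique (hpair _ .univ) (tendsto_const_nhds.congr fun n => ?_)
    rw [hav _ .univ]
    simp only [setIntegral_univ, hint]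
    simp only [Finset.sum_const, Finset.card_range, nsmul_eq_mul, mul_one]
    push_cast
    rw [inv_mul_cancel₀ (by positivity)]
  obtain ⟨μ, hμ, hd⟩ := exists_probabilityMeasure_of_density h0 h1
  refine ⟨μ, hd.isAcsm_iff.2 hh, ?_⟩
  have h2 : ∫ x in Uᶜ, h x ∂m = 0 := by
    refine tendsto_nhds_unique (hpair _ hU.compl) (tendsto_const_nhds.congr fun n => ?_)
    rw [hav _ hU.compl, Finset.sum_eq_zero, mul_zero]
    intro k _
    exact setIntegral_eq_zero_of_ae_eq_zero (hsupp k)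
  rw [← hd.real_apply hU.compl, measureReal_eq_zero_iff] at h2
  exact h2

end LasotaYorke

/-! ### Ergodic stationary measures -/

section ErgodicMeasures

variable {X : Type*} [MeasurableSpace X] {m μ : Measure X} {P : Kernel X X}

/-- An absorbing set is invariant with respect to every stationary measure. -/
lemma ae_eq_indicator_of_absorbing [IsFiniteMeasure μ]
    (hμ : ∀ A, MeasurableSet A → μ A = ∫⁻ x, P x A ∂μ) {A : Set X} (hA : MeasurableSet A)
    (h : ∀ᵐ x ∂μ, x ∈ A → P x A = 1) :
    ∀ᵐ x ∂μ, P x A = A.indicator (fun _ => (1 : ℝ≥0∞)) x := by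
  have hle : A.indicator (fun _ => (1 : ℝ≥0∞)) ≤ᵐ[μ] fun x => P x A := by
    filter_upwards [h] with x hx
    by_cases hxA : x ∈ A <;> simp [hxA, hx]
  have hi : ∫⁻ x, A.indicator (fun _ => (1 : ℝ≥0∞)) x ∂μ = μ A := by
    simp [lintegral_indicator hA]
  have := ae_eq_of_ae_le_of_lintegral_le hle (by rw [hi]; exact measure_ne_top _ _)
    (P.measurable_coe hA).aemeasurable (by rw [hi]; exact (hμ A hA).ge)
  filter_upwards [this] with x hx using hx.symm

lemma ae_compl_eq_indicator [IsMarkovKernel P] {A : Set X} (hA : MeasurableSet A)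
    (h : ∀ᵐ x ∂μ, P x A = A.indicator (fun _ => (1 : ℝ≥0∞)) x) :
    ∀ᵐ x ∂μ, P x Aᶜ = Aᶜ.indicator (fun _ => (1 : ℝ≥0∞)) x := by
  filter_upwards [h] with x hx
  rw [prob_compl_eq_one_sub hA, hx]
  by_cases hxA : x ∈ A <;> simp [hxA]

/-- Conditioning an acsm on an invariant set gives an acsm. -/
lemma IsAcsm.cond [IsMarkovKernel P] (hμ : IsAcsm P m μ) {A : Set X} (hA : MeasurableSet A)
    (h : ∀ᵐ x ∂μ, P x A = A.indicator (fun _ => (1 : ℝ≥0∞)) x) (h0 : μ A ≠ 0) :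
    IsAcsm P m μ[|A] := by
  obtain ⟨hp, hs, hac⟩ := hμ
  refine ⟨cond_isProbabilityMeasure h0, fun S hS => ?_, cond_absolutelyContinuous.trans hac⟩
  rw [cond_apply hA, ProbabilityTheory.cond, lintegral_smul_measure, smul_eq_mul,
    hs _ (hA.inter hS), ← lintegral_indicator hA]
  congr 1
  refine lintegral_congr_ae ?_
  filter_upwards [h, ae_compl_eq_indicator hA h] with x hx hx'
  by_cases hxA : x ∈ A
  · simp only [hxA, Set.indicator_of_mem, Set.mem_compl_iff, not_true_eq_false,
      not_false_eq_true, Set.indicator_of_notMem] at hx' ⊢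
    rw [Set.inter_comm]
    exact measure_inter_conull hx'
  · simp only [hxA, not_false_eq_true, Set.indicator_of_notMem] at hx ⊢
    exact measure_mono_null Set.inter_subset_left hx

/-- Compactness in `L¹` implies uniform integrability: sets charged fully by a density in `K` are
not small. -/
lemma exists_pos_le_measure_of_isCompact [IsFiniteMeasure m] {K : Set (X →₁[m] ℝ)}
    (hK : IsCompact K) : ∃ c > 0, ∀ f ∈ K, ∀ A, MeasurableSet A → ∫ x in A, f x ∂m = 1 →
      c ≤ m.real A := by
  by_contra! hcon
  choose f hf A hA hfA hmA using fun n : ℕ => hcon (1 / ((n : ℝ) + 1)) (by positivity)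
  obtain ⟨h, -, ψ, hψ, hlim⟩ := hK.tendsto_subseq hf
  have hm : Tendsto (fun n => m (A (ψ n))) atTop (𝓝 0) := by
    have h1 : Tendsto (fun n => m.real (A (ψ n))) atTop (𝓝 0) :=
      squeeze_zero (fun _ => measureReal_nonneg) (fun n => (hmA _).le)
        (tendsto_one_div_add_atTop_nhds_zero_nat.comp hψ.tendsto_atTop)
    have := ENNReal.tendsto_ofReal h1
    simpa [Measure.real] using this
  have h2 := (L1.integrable_coeFn h).tendsto_setIntegral_nhds_zero (s := fun n => A (ψ n)) hm
  have h3 : Tendsto (fun n => ‖f (ψ n) - h‖) atTop (𝓝 0) :=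
    tendsto_iff_norm_sub_tendsto_zero.1 hlim
  have h4 : ∀ n, 1 ≤ ∫ x in A (ψ n), h x ∂m + ‖f (ψ n) - h‖ := by
    intro n
    have e := abs_integral_mul_le (f (ψ n) - h) (measurable_indicator_one (hA (ψ n)))
      (abs_indicator_one_le _)
    rw [integral_sub_mul _ _ (measurable_indicator_one (hA (ψ n))) (abs_indicator_one_le _),
      integral_mul_indicator (hA _), integral_mul_indicator (hA _), hfA, one_mul] at e
    linarith [le_abs_self (1 - ∫ x in A (ψ n), h x ∂m)]
  have h5 := ge_of_tendsto' (h2.add h3) h4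
  norm_num at h5

/-- If the densities of all acsms lie in a compact subset of `L¹(m)`, every acsm dominates an
ergodic one. Invariant sets charged by an acsm have `m`-measure bounded below, so that repeated
splitting must stop. -/
lemma IsAcsm.exists_ergodic [IsMarkovKernel P] [IsFiniteMeasure m] {K : Set (X →₁[m] ℝ)}
    (hK : IsCompact K) (hKm : ∀ μ h, IsAcsm P m μ → IsDensity m μ h → h ∈ K)
    (hμ : IsAcsm P m μ) : ∃ μ', IsAcsm P m μ' ∧ IsErgodicStationary P μ' ∧ μ' ≪ μ := by
  obtain ⟨c, hc, hcK⟩ := exists_pos_le_measure_of_isCompact hK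
  have hlow : ∀ ρ, IsAcsm P m ρ → ∀ A, MeasurableSet A → ρ A = 1 → c ≤ m.real A := by
    intro ρ hρ A hA h1
    have := hρ.1
    obtain ⟨f, hf⟩ := exists_isDensity hρ.2.2
    refine hcK f (hKm ρ f hρ hf) A hA ?_
    rw [← hf.real_apply hA, Measure.real, h1, ENNReal.toReal_one]
  -- an acsm `ρ ≪ μ` living on a set `A` whose measure is within `c` of the infimum is ergodic: a
  -- splitting into two invariant parts, each of measure at least `c`, would beat the infimum
  set F : Set ℝ := {r | ∃ ρ A, IsAcsm P m ρ ∧ ρ ≪ μ ∧ MeasurableSet A ∧ ρ A = 1 ∧ m.real A = r}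
    with hF
  have hne : F.Nonempty := ⟨_, μ, Set.univ, hμ, .rfl, .univ, hμ.1.measure_univ, rfl⟩
  have hbdd : BddBelow F := ⟨0, by rintro _ ⟨ρ, A, -, -, -, -, rfl⟩; exact measureReal_nonneg⟩
  obtain ⟨_, ⟨ρ, A, hρ, hρμ, hA, hA1, rfl⟩, hr⟩ :=
    exists_lt_of_csInf_lt hne (lt_add_of_pos_right (sInf F) hc)
  refine ⟨ρ, hρ, fun S hS hinv => ?_, hρμ⟩
  by_contra! hcon
  have := hρ.1
  have hSc : ρ Sᶜ ≠ 0 := fun h => hcon.2 ((prob_compl_eq_zero_iff hS).1 h)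
  have hfull : ∀ E, MeasurableSet E → ρ E ≠ 0 → ρ[|E] (A ∩ E) = 1 := by
    intro E hE h0
    have hAE : ρ (E ∩ A) = ρ E :=
      measure_inter_conull ((prob_compl_eq_zero_iff hA).2 hA1)
    rw [cond_apply hE, Set.inter_comm A, ← Set.inter_assoc, Set.inter_self, hAE]
    exact ENNReal.inv_mul_cancel h0 (measure_ne_top _ _)
  have h1 : sInf F ≤ m.real (A ∩ S) := csInf_le hbdd
    ⟨ρ[|S], A ∩ S, hρ.cond hS hinv hcon.1, cond_absolutelyContinuous.trans hρμ, hA.inter hS,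
      hfull S hS hcon.1, rfl⟩
  have h2 : c ≤ m.real (A ∩ Sᶜ) :=
    hlow _ (hρ.cond hS.compl (ae_compl_eq_indicator hS hinv) hSc) _ (hA.inter hS.compl)
      (hfull _ hS.compl hSc)
  have h3 : m.real (A ∩ S) + m.real (A ∩ Sᶜ) = m.real A := by
    rw [← Set.sdiff_eq]
    exact measureReal_inter_add_sdiff hS
  linarith

/-- The set where a fixed point of the transfer operator is positive is absorbing. -/
lemma IsTransfer.ae_absorbing_pos [IsMarkovKernel P] {d : X →₁[m] ℝ}
    (hd : IsTransfer P m d d) : ∀ᵐ x ∂m, x ∈ {x | 0 < d x} → P x {x | 0 < d x} = 1 := by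
  have hmd : Measurable d := (Lp.stronglyMeasurable d).measurable
  set A : Set X := {x | 0 < d x} with hAdef
  have hA : MeasurableSet A := measurableSet_lt measurable_const hmd
  have hPA : Measurable fun x => (P x).real A := (P.measurable_coe hA).ennreal_toReal
  have hPA1 : ∀ x, |(P x).real A| ≤ 1 := fun x => by
    rw [abs_of_nonneg measureReal_nonneg]
    exact measureReal_le_one
  have hi1 := integrable_mul_of_bdd d (measurable_indicator_one hA) (abs_indicator_one_le A)
  have hi2 := integrable_mul_of_bdd d hPA hPA1
  -- `d · (1_A - P 1_A)` is nonnegative and, by invariance of `d`, has integral zero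
  have h0 : ∀ x, 0 ≤ d x * A.indicator 1 x - d x * (P x).real A := by
    intro x
    rw [← mul_sub]
    by_cases hx : x ∈ A
    · rw [Set.indicator_of_mem hx]
      exact mul_nonneg (le_of_lt hx) (sub_nonneg.2 measureReal_le_one)
    · rw [Set.indicator_of_notMem hx]
      exact mul_nonneg_of_nonpos_of_nonpos (not_lt.1 hx)
        (sub_nonpos.2 measureReal_nonneg)
  have hint : ∫ x, (d x * A.indicator 1 x - d x * (P x).real A) ∂m = 0 := by
    rw [integral_sub hi1 hi2, integral_mul_indicator hA, hd.setIntegral_eq hA, sub_self]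
  rw [integral_eq_zero_iff_of_nonneg h0 (hi1.sub hi2)] at hint
  filter_upwards [hint] with x hx hxA
  simp only [Pi.zero_apply, Set.indicator_of_mem hxA, Pi.one_apply, mul_one] at hx
  have hd0 : d x ≠ 0 := ne_of_gt hxA
  have h1 : (P x).real A = 1 := by
    have : d x * (1 - (P x).real A) = 0 := by linarith
    rcases mul_eq_zero.1 this with h | h
    · exact absurd h hd0
    · linarith
  rwa [Measure.real, ENNReal.toReal_eq_one_iff] at h1

/-- Distinct ergodic acsms are mutually singular: if `d` is the difference of their densities, then
`{d > 0}` is an invariant set which separates them. -/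
lemma IsAcsm.mutuallySingular [IsMarkovKernel P] [IsFiniteMeasure m] {μ' : Measure X}
    (hμ : IsAcsm P m μ) (hμe : IsErgodicStationary P μ) (hμ' : IsAcsm P m μ')
    (hμe' : IsErgodicStationary P μ') (hne : μ ≠ μ') : μ ⟂ₘ μ' := by
  have := hμ.1
  have := hμ'.1
  obtain ⟨h, hh⟩ := exists_isDensity hμ.2.2
  obtain ⟨h', hh'⟩ := exists_isDensity hμ'.2.2
  have hd := (hh.isAcsm_iff.1 hμ).sub (hh'.isAcsm_iff.1 hμ')
  have habs := hd.ae_absorbing_pos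
  have hmd : Measurable (h - h' : X →₁[m] ℝ) := (Lp.stronglyMeasurable _).measurable
  set A : Set X := {x | 0 < (h - h' : X →₁[m] ℝ) x} with hAdef
  have hA : MeasurableSet A := measurableSet_lt measurable_const hmd
  have hAx : ∀ᵐ x ∂m, x ∈ A ↔ h' x < h x := by
    filter_upwards [Lp.coeFn_sub h h'] with x hx
    rw [hAdef, Set.mem_ofPred_eq, hx, Pi.sub_apply, sub_pos]
  rcases hμe A hA (ae_eq_indicator_of_absorbing hμ.2.1 hA (hμ.2.2.ae_le habs)) with h0 | h1
  · -- then `h ≤ h'` almost everywhere, and both have integral one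
    exfalso
    have hle : ∀ᵐ x ∂m, h x ≤ h' x := by
      filter_upwards [(hh.apply_eq_zero_iff hA).1 h0, hAx, hh'.nonneg] with x hx hx' hx0
      by_contra! hlt
      have := hx (hx'.2 hlt)
      linarith
    have heq : ∫ x, h x ∂m = ∫ x, h' x ∂m := by
      rw [← hh.norm_eq, ← hh'.norm_eq, hh.norm_eq_one, hh'.norm_eq_one]
    have := (integral_eq_iff_of_ae_le (L1.integrable_coeFn h) (L1.integrable_coeFn h') hle).1 heq
    refine hne (hh.eq_withDensity.trans (Eq.trans (withDensity_congr_ae ?_)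
      hh'.eq_withDensity.symm))
    filter_upwards [this] with x hx
    rw [hx]
  · rcases hμe' A hA (ae_eq_indicator_of_absorbing hμ'.2.1 hA (hμ'.2.2.ae_le habs)) with h0' | h1'
    · exact ⟨Aᶜ, hA.compl, (prob_compl_eq_zero_iff hA).2 h1, by rwa [compl_compl]⟩
    · exfalso
      have hint : ∫ x in A, (h - h' : X →₁[m] ℝ) x ∂m = 0 := by
        rw [← integral_mul_indicator hA, integral_sub_mul _ _ (measurable_indicator_one hA)
          (abs_indicator_one_le A), integral_mul_indicator hA, integral_mul_indicator hA,
          ← hh.real_apply hA, ← hh'.real_apply hA, Measure.real, Measure.real, h1, h1', sub_self]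
      rw [setIntegral_eq_zero_iff_of_nonneg_ae ((ae_restrict_iff' hA).2
        (.of_forall fun x hx => le_of_lt hx)) (L1.integrable_coeFn _).integrableOn,
        EventuallyEq, ae_restrict_iff' hA] at hint
      have hA0 : m A = 0 := by
        rw [measure_eq_zero_iff_ae_notMem]
        filter_upwards [hint] with x hx hxA
        exact (ne_of_gt hxA) (hx hxA)
      rw [hμ.2.2 hA0] at h1
      exact zero_ne_one h1

end ErgodicMeasures

/-! ### Pseudo-orbits, supports and carriers -/

section Reach

variable {X : Type*} [PseudoMetricSpace X] {T : X → X} {ε δ : ℝ} {A S : Set X}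

/-- `A` is forward invariant under `ε`-perturbations of `T`: the `ε`-ball around `T x` is contained
in `A` for every continuity point `x ∈ A`. -/
def IsPseudoInvariant (T : X → X) (ε : ℝ) (A : Set X) : Prop :=
  ∀ x ∈ A, ContinuousAt T x → Metric.ball (T x) ε ⊆ A

/-- The set of endpoints of `ε`-pseudo-orbits which start in `S`. -/
def reach (T : X → X) (ε : ℝ) (S : Set X) : Set X :=
  {y | ∃ (n : ℕ) (x : ℕ → X), IsPseudoOrbit T ε n x ∧ x 0 ∈ S ∧ x n = y}

lemma subset_reach : S ⊆ reach T ε S := fun y hy =>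
  ⟨0, fun _ => y, by simp [IsPseudoOrbit], hy, rfl⟩

lemma reach_mono (h : ε ≤ δ) : reach T ε S ⊆ reach T δ S := by
  rintro y ⟨n, x, hx, h0, hn⟩
  exact ⟨n, x, fun i hi => ⟨(hx i hi).1, (hx i hi).2.trans_le h⟩, h0, hn⟩

lemma isPseudoInvariant_reach : IsPseudoInvariant T ε (reach T ε S) := by
  rintro _ ⟨n, x, hx, h0, rfl⟩ hc y hy
  refine ⟨n + 1, fun i => if i ≤ n then x i else y, fun i hi => ?_, by simpa, by simp⟩
  rcases (Nat.lt_succ_iff.1 hi).lt_or_eq with h | rfl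
  · simpa [h.le, Nat.succ_le_of_lt h] using hx i h
  · rw [Metric.mem_ball, dist_comm] at hy
    simpa [hc] using hy

lemma IsPseudoInvariant.reach_subset (hA : IsPseudoInvariant T ε A) (hS : S ⊆ A) :
    reach T ε S ⊆ A := by
  rintro _ ⟨n, x, hx, h0, rfl⟩
  have : ∀ i ≤ n, x i ∈ A := by
    intro i
    induction i with
    | zero => exact fun _ => hS h0
    | succ i ih =>
      intro hi
      refine hA (x i) (ih (by omega)) (hx i (by omega)).1 ?_
      rw [Metric.mem_ball, dist_comm]
      exact (hx i (by omega)).2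
  exact this n le_rfl

/-- The set reached from `S` is open as soon as it contains a neighbourhood of `S`: all points which
are not in `S` are reached by a last step, which leads to a whole ball. -/
lemma isOpen_reach (h : ∀ x ∈ S, reach T ε S ∈ 𝓝 x) : IsOpen (reach T ε S) := by
  rw [isOpen_iff_mem_nhds]
  rintro _ ⟨n, x, hx, h0, rfl⟩
  cases n with
  | zero => exact h _ h0
  | succ n =>
    have h1 := hx n n.lt_succ_self
    refine mem_of_superset (Metric.isOpen_ball.mem_nhds ?_) (isPseudoInvariant_reach (x n)
      ⟨n, x, fun i hi => hx i (by omega), h0, rfl⟩ h1.1)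
    rw [Metric.mem_ball, dist_comm]
    exact h1.2

variable [MeasurableSpace X] {μ ν : Measure X}

lemma leads_iff : Leads T μ ν ↔ ∀ ε > 0, (reach T ε μ.support ∩ ν.support).Nonempty := by
  refine forall₂_congr fun ε _ => ⟨?_, ?_⟩
  · rintro ⟨n, x, hx, h0, hn⟩
    exact ⟨x n, ⟨n, x, hx, h0, rfl⟩, hn⟩
  · rintro ⟨_, ⟨n, x, hx, h0, rfl⟩, hn⟩
    exact ⟨n, x, hx, h0, hn⟩

lemma measure_ne_zero_of_inter_support {V : Set X} (hV : IsOpen V)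
    (h : (V ∩ μ.support).Nonempty) : μ V ≠ 0 := by
  obtain ⟨x, hx, hxs⟩ := h
  exact ((Measure.mem_support_iff_forall x).1 hxs V (hV.mem_nhds hx)).ne'

end Reach

section Deterministic

variable {X : Type*} [MeasurableSpace X] {T : X → X} {m μ : Measure X}

lemma isAcsm_deterministic_iff (hT : Measurable T) :
    IsAcsm (Kernel.deterministic T hT) m μ ↔
      IsProbabilityMeasure μ ∧ MeasurePreserving T μ μ ∧ μ ≪ m := by
  refine and_congr_right fun _ => and_congr_left fun _ => ?_
  have hpre : ∀ A, MeasurableSet A →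
      ∫⁻ x, Kernel.deterministic T hT x A ∂μ = μ.map T A := by
    intro A hA
    rw [Measure.map_apply hT hA, ← lintegral_indicator_one (hT hA)]
    refine lintegral_congr fun x => ?_
    rw [Kernel.deterministic_apply' hT x hA]
    rfl
  constructor
  · intro h
    refine ⟨hT, ?_⟩
    ext A hA
    rw [← hpre A hA, ← h A hA]
  · intro h A hA
    rw [hpre A hA, h.map_eq]

lemma IsErgodicAcim.isAcsm (hT : Measurable T) (hμ : IsErgodicAcim T m μ) :
    IsAcsm (Kernel.deterministic T hT) m μ :=
  (isAcsm_deterministic_iff hT).2 ⟨hμ.1, hμ.2.1.toMeasurePreserving, hμ.2.2⟩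

lemma IsAcsm.isErgodicAcim (hT : Measurable T) (hμ : IsAcsm (Kernel.deterministic T hT) m μ)
    (he : IsErgodicStationary (Kernel.deterministic T hT) μ) : IsErgodicAcim T m μ := by
  obtain ⟨hp, hmp, hac⟩ := (isAcsm_deterministic_iff hT).1 hμ
  refine ⟨hp, ⟨hmp, ⟨fun A hA hTA => ?_⟩⟩, hac⟩
  rw [eventuallyConst_set']
  have hinv : ∀ x, Kernel.deterministic T hT x A = A.indicator (fun _ => (1 : ℝ≥0∞)) x := by
    intro x
    rw [Kernel.deterministic_apply' hT x hA]
    change (T ⁻¹' A).indicator (fun _ => (1 : ℝ≥0∞)) x = _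
    rw [hTA]
  rcases he A hA (.of_forall hinv) with h | h
  · exact .inl (ae_eq_empty.2 h)
  · exact .inr (eventuallyEq_univ.2 (mem_ae_iff.2 ((prob_compl_eq_zero_iff hA).2 h)))

end Deterministic

section Acim

variable {X : Type*} [PseudoMetricSpace X] [MeasurableSpace X] {T : X → X} {ε : ℝ} {A : Set X}
  {m μ ν ρ : Measure X}

lemma IsErgodicAcim.ae_mem (hμ : IsErgodicAcim T m μ) (hT : m {x | ¬ ContinuousAt T x} = 0)
    (hε : 0 < ε) (hAm : MeasurableSet A) (hA : IsPseudoInvariant T ε A) (h0 : μ A ≠ 0) :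
    ∀ᵐ x ∂μ, x ∈ A := by
  have := hμ.1
  have h2 : ∀ᵐ y ∂μ, ContinuousAt T y := hμ.2.2 hT
  have hle : A ≤ᵐ[μ] T ⁻¹' A := by
    filter_upwards [h2] with x hx hxA
    exact hA x hxA hx (Metric.mem_ball_self hε)
  rcases hμ.2.1.ae_empty_or_univ_of_ae_le_preimage hAm.nullMeasurableSet hle with h | h
  · exact absurd (by rw [measure_congr h, measure_empty]) h0
  · exact eventuallyEq_univ.1 h

lemma IsErgodicAcim.support_nonempty [SecondCountableTopology X] (hμ : IsErgodicAcim T m μ) :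
    μ.support.Nonempty :=
  have := hμ.1
  Measure.nonempty_support (IsProbabilityMeasure.ne_zero μ)

lemma Leads.refl [SecondCountableTopology X] (hμ : IsErgodicAcim T m μ) : Leads T μ μ :=
  leads_iff.2 fun _ _ => hμ.support_nonempty.mono fun _ hx => ⟨subset_reach hx, hx⟩

variable [BorelSpace X]

/-- A pseudo-invariant set which carries an acim `μ` contains the `ε`-neighbourhood of the support
of `μ`, since images of its continuity points are dense in the support. -/
lemma IsErgodicAcim.ball_subset (hμ : IsErgodicAcim T m μ) (hT : m {x | ¬ ContinuousAt T x} = 0)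
    (hA : IsPseudoInvariant T ε A) (hμA : ∀ᵐ x ∂μ, x ∈ A) {x : X} (hx : x ∈ μ.support) :
    Metric.ball x ε ⊆ A := by
  intro z hz
  have hr : 0 < ε - dist z x := sub_pos.2 hz
  have h1 : μ (T ⁻¹' Metric.ball x (ε - dist z x)) ≠ 0 := by
    rw [hμ.2.1.measure_preimage Metric.isOpen_ball.nullMeasurableSet]
    exact measure_ne_zero_of_inter_support Metric.isOpen_ball ⟨x, Metric.mem_ball_self hr, hx⟩
  have h2 : ∀ᵐ y ∂μ, ContinuousAt T y := hμ.2.2 hT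
  obtain ⟨y, hy, hyA, hyc⟩ :=
    ((frequently_ae_mem_iff.2 h1).and_eventually (hμA.and h2)).exists
  refine hA y hyA hyc ?_
  rw [Set.mem_preimage, Metric.mem_ball] at hy
  rw [Metric.mem_ball]
  have := dist_triangle_right z (T y) x
  linarith

lemma IsErgodicAcim.support_subset (hμ : IsErgodicAcim T m μ)
    (hT : m {x | ¬ ContinuousAt T x} = 0) (hε : 0 < ε) (hAm : MeasurableSet A)
    (hA : IsPseudoInvariant T ε A) (h0 : μ A ≠ 0) : μ.support ⊆ A := fun _ hx =>
  hμ.ball_subset hT hA (hμ.ae_mem hT hε hAm hA h0) hx (Metric.mem_ball_self hε)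

variable [SecondCountableTopology X]

lemma IsErgodicAcim.isOpen_reach (hμ : IsErgodicAcim T m μ)
    (hT : m {x | ¬ ContinuousAt T x} = 0) (hε : 0 < ε) : IsOpen (reach T ε μ.support) := by
  refine PseudoOrbits.isOpen_reach fun x hx => mem_of_superset (Metric.ball_mem_nhds x hε) ?_
  refine hμ.ball_subset hT isPseudoInvariant_reach ?_ hx
  filter_upwards [Measure.support_mem_ae] with y hy using subset_reach hy

/-- If `μ → ν`, a pseudo-invariant set charged by `μ` is charged by `ν`. -/
lemma Leads.measure_ne_zero (h : Leads T μ ν) (hμ : IsErgodicAcim T m μ)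
    (hT : m {x | ¬ ContinuousAt T x} = 0) (hε : 0 < ε) (hAm : MeasurableSet A)
    (hA : IsPseudoInvariant T ε A) (h0 : μ A ≠ 0) : ν A ≠ 0 := by
  have h1 : ν (reach T ε μ.support) ≠ 0 :=
    measure_ne_zero_of_inter_support (hμ.isOpen_reach hT hε) (leads_iff.1 h ε hε)
  exact fun h2 => h1 (measure_mono_null
    (hA.reach_subset (hμ.support_subset hT hε hAm hA h0)) h2)

lemma Leads.support_subset_reach (h : Leads T μ ν) (hμ : IsErgodicAcim T m μ)
    (hν : IsErgodicAcim T m ν) (hT : m {x | ¬ ContinuousAt T x} = 0) (hε : 0 < ε) :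
    ν.support ⊆ reach T ε μ.support :=
  have hopen := hμ.isOpen_reach hT hε
  hν.support_subset hT hε hopen.measurableSet isPseudoInvariant_reach
    (measure_ne_zero_of_inter_support hopen (leads_iff.1 h ε hε))

lemma Leads.trans (h : Leads T μ ν) (h' : Leads T ν ρ) (hμ : IsErgodicAcim T m μ)
    (hν : IsErgodicAcim T m ν) (hT : m {x | ¬ ContinuousAt T x} = 0) : Leads T μ ρ := by
  refine leads_iff.2 fun ε hε => (leads_iff.1 h' ε hε).mono ?_
  exact Set.inter_subset_inter_left _ (isPseudoInvariant_reach.reach_subset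
    (h.support_subset_reach hμ hν hT hε))

end Acim

section Acsm

variable {X : Type*} [PseudoMetricSpace X] [SecondCountableTopology X] [MeasurableSpace X]
  {T : X → X} {ε : ℝ} {m μ : Measure X} {P : Kernel X X}

/-- A pseudo-invariant set is absorbing: the closed ball that supports `P x` differs from the open
ball by a null set. -/
lemma IsPseudoInvariant.ae_absorbing {U : Set X} (hU : IsPseudoInvariant T ε U) (hε : 0 < ε)
    (hT : m {x | ¬ ContinuousAt T x} = 0)
    (hm : ∀ x r, 0 < r → m (Metric.sphere x r) = 0) (hPm : ∀ x, P x ≪ m)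
    (hP : ∀ x, (P x).support = closure (Metric.ball (T x) ε)) :
    ∀ᵐ x ∂m, x ∈ U → P x Uᶜ = 0 := by
  have h2 : ∀ᵐ y ∂m, ContinuousAt T y := hT
  filter_upwards [h2] with x hx hxU
  refine measure_mono_null (t := (P x).supportᶜ ∪ Metric.sphere (T x) ε) (fun y hy => ?_)
    (measure_union_null Measure.measure_compl_support (hPm x (hm _ _ hε)))
  by_cases hys : y ∈ (P x).support
  · right
    rw [hP x] at hys
    have h3 : dist y (T x) ≤ ε := Metric.closure_ball_subset_closedBall hys
    exact le_antisymm h3 (not_lt.1 fun h4 => hy (hU x hxU hx h4))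
  · exact .inl hys

variable [BorelSpace X]

lemma IsAcsm.isPseudoInvariant_support (hμ : IsAcsm P m μ)
    (hP : ∀ x, (P x).support = closure (Metric.ball (T x) ε)) :
    IsPseudoInvariant T ε μ.support := by
  intro x hx hc y hy
  have hcl : MeasurableSet μ.support := Measure.isClosed_support.measurableSet
  have h1 : ∀ᵐ x ∂μ, P x μ.supportᶜ = 0 := by
    have h2 := hμ.2.1 _ hcl.compl
    rw [Measure.measure_compl_support] at h2
    exact (lintegral_eq_zero_iff (P.measurable_coe hcl.compl)).1 h2.symm
  have hn : {x' | dist y (T x') < ε} ∈ 𝓝 x :=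
    (tendsto_const_nhds.dist hc).eventually_lt_const hy
  obtain ⟨x', hx', hPx'⟩ := ((frequently_ae_mem_iff.2
    ((Measure.mem_support_iff_forall x).1 hx _ hn).ne').and_eventually h1).exists
  have h3 := Measure.support_subset_of_isClosed Measure.isClosed_support
    (mem_ae_iff.2 hPx')
  rw [hP x'] at h3
  exact h3 (subset_closure hx')

end Acsm

section Carrier

variable {X : Type*} [TopologicalSpace X] [MeasurableSpace X] {m μ : Measure X} {W : Set X}

/-- `W` is an open set of full `μ`-measure on which `m` is absolutely continuous with respect
to `μ`. -/
structure IsOpenCarrier (m μ : Measure X) (W : Set X) : Prop where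
  isOpen : IsOpen W
  measure_compl : μ Wᶜ = 0
  measure_inter : ∀ A, MeasurableSet A → μ A = 0 → m (A ∩ W) = 0

namespace IsOpenCarrier

lemma inter_nonempty (hW : IsOpenCarrier m μ W) {A : Set X} (h : μ A ≠ 0) :
    (W ∩ A).Nonempty := by
  by_contra hcon
  rw [Set.not_nonempty_iff_eq_empty, ← Set.disjoint_iff_inter_eq_empty] at hcon
  exact h (measure_mono_null hcon.symm.subset_compl_right hW.measure_compl)

variable [m.IsOpenPosMeasure]

/-- Carriers of mutually singular measures are disjoint. -/
lemma disjoint {ν : Measure X} {W' : Set X} (hW : IsOpenCarrier m μ W)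
    (hW' : IsOpenCarrier m ν W') (h : μ ⟂ₘ ν) : Disjoint W W' := by
  obtain ⟨S, hS, h0, h1⟩ := h
  have h2 : m (W ∩ W') = 0 := by
    refine measure_mono_null (t := (S ∩ W) ∪ (Sᶜ ∩ W')) (fun x hx => ?_)
      (measure_union_null (hW.measure_inter S hS h0) (hW'.measure_inter _ hS.compl h1))
    by_cases hxS : x ∈ S
    · exact .inl ⟨hxS, hx.1⟩
    · exact .inr ⟨hxS, hx.2⟩
  rw [(hW.isOpen.inter hW'.isOpen).measure_eq_zero_iff m] at h2
  exact Set.disjoint_iff_inter_eq_empty.2 h2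

variable [BorelSpace X]

lemma measure_ne_zero (hW : IsOpenCarrier m μ W) {V : Set X} (hV : IsOpen V)
    (h : (W ∩ V).Nonempty) : μ V ≠ 0 := by
  intro h0
  have := hW.measure_inter V hV.measurableSet h0
  rw [Set.inter_comm, (hW.isOpen.inter hV).measure_eq_zero_iff m] at this
  exact h.ne_empty this

lemma subset_support (hW : IsOpenCarrier m μ W) : W ⊆ μ.support := by
  intro x hx
  rw [Measure.support_eq_forall_isOpen]
  exact fun V hxV hV => pos_iff_ne_zero.2 (hW.measure_ne_zero hV ⟨x, hx, hxV⟩)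

end IsOpenCarrier

/-- A measure with an almost everywhere continuous density `g` is carried by the interior of
`{g > 0}`. -/
lemma IsDensity.exists_isOpenCarrier [BorelSpace X] {h : X →₁[m] ℝ}
    (hμ : IsDensity m μ h) {g : X → ℝ} (hg : ∀ᵐ x ∂m, h x = g x)
    (hgc : m {x | ¬ ContinuousAt g x} = 0) : ∃ W, IsOpenCarrier m μ W := by
  refine ⟨interior {x | 0 < g x}, isOpen_interior, ?_, fun A hA h0 => ?_⟩
  · rw [hμ.apply_eq_zero_iff isOpen_interior.measurableSet.compl]
    have h2 : ∀ᵐ y ∂m, ContinuousAt g y := hgc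
    filter_upwards [hg, hμ.nonneg, h2] with x hx hx0 hc hxW
    by_contra hne
    refine hxW (mem_interior_iff_mem_nhds.2 (hc.eventually_const_lt ?_))
    rw [← hx]
    exact lt_of_le_of_ne hx0 (Ne.symm hne)
  · rw [hμ.apply_eq_zero_iff hA] at h0
    rw [measure_eq_zero_iff_ae_notMem]
    filter_upwards [h0, hg] with x hx hxg ⟨hxA, hxW⟩
    have h3 : x ∈ {x | 0 < g x} := interior_subset hxW
    rw [Set.mem_ofPred_eq] at h3
    rw [← hxg, hx hxA] at h3
    exact lt_irrefl _ h3

end Carrier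

/-! ### Random perturbations -/

section RandomTransfer

variable {X : Type*} [MeasurableSpace X] {m : Measure X} {P : Kernel X X}

lemma integrable_density_mul [SFinite m] [IsMarkovKernel P] {p : X → X → ℝ≥0∞}
    (hp : Measurable fun z : X × X => p z.1 z.2) (hP : ∀ x, P x = m.withDensity (p x))
    (f : X →₁[m] ℝ) {φ : X → ℝ} (hφ : Measurable φ) {C : ℝ} (hC : ∀ x, |φ x| ≤ C) :
    Integrable (fun w : X × X => (p w.1 w.2).toReal * f w.1 * φ w.2) (m.prod m) := by
  have hf : Measurable f := (Lp.stronglyMeasurable f).measurable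
  have hp1 : ∀ z, Measurable (p z) := fun z => hp.comp measurable_prodMk_left
  have hlp : ∀ z, ∫⁻ x, p z x ∂m = 1 := fun z => by
    have := measure_univ (μ := P z)
    rwa [hP z, withDensity_apply _ .univ, Measure.restrict_univ] at this
  have hpi : ∀ z, Integrable (fun x => (p z x).toReal) m := fun z =>
    integrable_toReal_of_lintegral_ne_top (hp1 z).aemeasurable (by simp [hlp])
  have hp2 : ∀ z, ∫ x, (p z x).toReal ∂m = 1 := fun z => by
    rw [integral_toReal (hp1 z).aemeasurable (ae_lt_top (hp1 z) (by simp [hlp])), hlp,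
      ENNReal.toReal_one]
  have hmeas : Measurable fun w : X × X => (p w.1 w.2).toReal * f w.1 * φ w.2 :=
    (hp.ennreal_toReal.mul (hf.comp measurable_fst)).mul (hφ.comp measurable_snd)
  have hsec : ∀ z, Integrable (fun x => (p z x).toReal * f z * φ x) m := fun z =>
    ((hpi z).mul_const (f z)).mul_bdd (c := C) hφ.aestronglyMeasurable (.of_forall hC)
  rw [integrable_prod_iff hmeas.aestronglyMeasurable]
  refine ⟨.of_forall hsec, ((L1.integrable_coeFn f).norm.const_mul C).mono'
    hmeas.aestronglyMeasurable.norm.integral_prod_right' (.of_forall fun z => ?_)⟩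
  rw [Real.norm_of_nonneg (integral_nonneg fun x => norm_nonneg _)]
  calc ∫ x, ‖(p z x).toReal * f z * φ x‖ ∂m
      ≤ ∫ x, (p z x).toReal * (C * ‖f z‖) ∂m := by
        refine integral_mono (hsec z).norm ((hpi z).mul_const _) fun x => ?_
        dsimp only
        rw [norm_mul, norm_mul, Real.norm_of_nonneg ENNReal.toReal_nonneg, mul_assoc, mul_comm C]
        gcongr
        exact hC x
    _ = C * ‖f z‖ := by rw [integral_mul_const, hp2, one_mul]

/-- The integral operator with kernel `p` is the transfer operator of the Markov kernel with
density `p`. -/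
lemma isTransfer_of_randomTransfer [SFinite m] [IsMarkovKernel P] {p : X → X → ℝ≥0∞}
    (hp : Measurable fun z : X × X => p z.1 z.2) (hP : ∀ x, P x = m.withDensity (p x))
    {f g : X →₁[m] ℝ} (hg : ∀ᵐ x ∂m, g x = randomTransfer m p f x) : IsTransfer P m f g := by
  rintro φ hφ ⟨C, hC⟩
  have hp1 : ∀ z, Measurable (p z) := fun z => hp.comp measurable_prodMk_left
  have hfin : ∀ z, ∀ᵐ x ∂m, p z x < ∞ := fun z => by
    refine ae_lt_top (hp1 z) ?_
    have := measure_univ (μ := P z)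
    rw [hP z, withDensity_apply _ .univ, Measure.restrict_univ] at this
    simp [this]
  calc ∫ z, f z * ∫ y, φ y ∂P z ∂m
      = ∫ z, ∫ x, (p z x).toReal * f z * φ x ∂m ∂m := by
        refine integral_congr_ae (.of_forall fun z => ?_)
        dsimp only
        rw [hP z, integral_withDensity_eq_integral_toReal_smul (hp1 z) (hfin z),
          ← integral_const_mul]
        refine integral_congr_ae (.of_forall fun x => ?_)
        simp only [smul_eq_mul]
        ring
    _ = ∫ x, ∫ z, (p z x).toReal * f z * φ x ∂m ∂m :=
        integral_integral_swap (integrable_density_mul hp hP f hφ hC)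
    _ = ∫ x, g x * φ x ∂m := by
        refine integral_congr_ae ?_
        filter_upwards [hg] with x hx
        rw [integral_mul_const, hx, randomTransfer]

lemma isTransfer_deterministic {T : X → X} (hT : Measurable T) {f g : X →₁[m] ℝ}
    (h : IsPerronFrobenius T m f g) : IsTransfer (Kernel.deterministic T hT) m f g := by
  intro φ hφ hC
  rw [← h φ hφ hC]
  refine integral_congr_ae (.of_forall fun x => ?_)
  dsimp only
  rw [Kernel.integral_deterministic' hT hφ.stronglyMeasurable]

end RandomTransfer

section Limits

variable {X : Type*} [MeasurableSpace X] {m : Measure X}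

/-- A limit in `L¹(m)` of densities of probability measures is the density of a probability measure,
and the integrals of bounded measurable functions converge. -/
lemma exists_measure_of_tendsto {μ : ℕ → Measure X} {f : ℕ → X →₁[m] ℝ} {h : X →₁[m] ℝ}
    (hμ : ∀ n, IsProbabilityMeasure (μ n)) (hf : ∀ n, IsDensity m (μ n) (f n))
    (hlim : Tendsto f atTop (𝓝 h)) :
    ∃ ν, IsProbabilityMeasure ν ∧ IsDensity m ν h ∧ ∀ φ : X → ℝ, Measurable φ →
      (∃ C, ∀ x, |φ x| ≤ C) → Tendsto (fun n => ∫ x, φ x ∂μ n) atTop (𝓝 (∫ x, φ x ∂ν)) := by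
  have hset : ∀ A, MeasurableSet A →
      Tendsto (fun n => (μ n).real A) atTop (𝓝 (∫ x in A, h x ∂m)) := by
    intro A hA
    have := tendsto_integral_mul hlim (measurable_indicator_one hA) ⟨1, abs_indicator_one_le A⟩
    rw [integral_mul_indicator hA] at this
    refine this.congr fun n => ?_
    rw [integral_mul_indicator hA, (hf n).real_apply hA]
  have h0 : ∀ᵐ x ∂m, 0 ≤ h x :=
    ae_nonneg_of_forall_setIntegral_nonneg (L1.integrable_coeFn h) fun A hA _ =>
      ge_of_tendsto' (hset A hA) fun n => measureReal_nonneg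
  have h1 : ∫ x, h x ∂m = 1 := by
    have := hset _ .univ
    simp only [probReal_univ, setIntegral_univ] at this
    exact tendsto_nhds_unique this tendsto_const_nhds
  obtain ⟨ν, hν, hd⟩ := exists_probabilityMeasure_of_density h0 h1
  refine ⟨ν, hν, hd, fun φ hφ hC => ?_⟩
  rw [hd.integral_eq]
  refine (tendsto_integral_mul hlim hφ hC).congr fun n => ?_
  rw [(hf n).integral_eq]

lemma measure_eq_zero_of_tendsto {μ : ℕ → Measure X} {ν : Measure X} [IsFiniteMeasure ν]
    (hlim : ∀ φ : X → ℝ, Measurable φ → (∃ C, ∀ x, |φ x| ≤ C) →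
      Tendsto (fun n => ∫ x, φ x ∂μ n) atTop (𝓝 (∫ x, φ x ∂ν))) {A : Set X} (hA : MeasurableSet A)
    (h : ∀ᶠ n in atTop, μ n A = 0) : ν A = 0 := by
  have h1 := hlim _ (measurable_indicator_one hA) ⟨1, abs_indicator_one_le A⟩
  simp only [integral_indicator_one hA] at h1
  rw [← measureReal_eq_zero_iff]
  refine tendsto_nhds_unique h1 (tendsto_const_nhds.congr' ?_)
  filter_upwards [h] with n hn
  rw [Measure.real, hn, ENNReal.toReal_zero]

/-- Limits of acsms of `ε`-perturbations of `T`, as `ε → 0`, are invariant under `T`. Continuity of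
`T` is not needed, because the densities converge in `L¹`. -/
lemma measurePreserving_of_tendsto [PseudoMetricSpace X] [CompactSpace X]
    [SecondCountableTopology X] [BorelSpace X] {T : X → X} (hT : Measurable T) {P : ℕ → Kernel X X}
    {e : ℕ → ℝ} (he : Tendsto e atTop (𝓝 0)) (hP : ∀ n, IsMarkovKernel (P n))
    (hsupp : ∀ n x, (P n x).support = closure (Metric.ball (T x) (e n)))
    {μ : ℕ → Measure X} {ν : Measure X} [IsProbabilityMeasure ν] (hμ : ∀ n, IsAcsm (P n) m (μ n))
    (hlim : ∀ φ : X → ℝ, Measurable φ → (∃ C, ∀ x, |φ x| ≤ C) →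
      Tendsto (fun n => ∫ x, φ x ∂μ n) atTop (𝓝 (∫ x, φ x ∂ν))) : MeasurePreserving T ν ν := by
  refine ⟨hT, ?_⟩
  have := Measure.isProbabilityMeasure_map (μ := ν) hT.aemeasurable
  refine ext_of_forall_integral_eq_of_IsFiniteMeasure fun φ => ?_
  have hφ : Measurable φ := φ.continuous.measurable
  have hC : ∀ x, |φ x| ≤ ‖φ‖ := φ.norm_coe_le_norm
  rw [integral_map hT.aemeasurable φ.continuous.aestronglyMeasurable]
  have h1 := hlim φ hφ ⟨_, hC⟩
  have h2 := hlim (fun x => φ (T x)) (hφ.comp hT) ⟨_, fun x => hC (T x)⟩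
  have hdiff : Tendsto (fun n => ∫ x, φ x ∂μ n - ∫ x, φ (T x) ∂μ n) atTop (𝓝 0) := by
    rw [Metric.tendsto_atTop']
    intro δ hδ
    obtain ⟨r, hr, hrφ⟩ := Metric.uniformContinuous_iff.1
      (CompactSpace.uniformContinuous_of_continuous φ.continuous) (δ / 2) (half_pos hδ)
    obtain ⟨N, hN⟩ := eventually_atTop.1 (he.eventually_lt_const hr)
    refine ⟨N, fun n hn => ?_⟩
    have hp := (hμ n).1
    have hloc : ∀ x, |∫ y, φ y ∂P n x - φ (T x)| ≤ δ / 2 := by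
      intro x
      have hi : Integrable φ (P n x) :=
        Integrable.of_bound hφ.aestronglyMeasurable _ (.of_forall hC)
      have hb : ∀ᵐ y ∂P n x, ‖φ y - φ (T x)‖ ≤ δ / 2 := by
        filter_upwards [Measure.support_mem_ae] with y hy
        rw [hsupp] at hy
        have hd : dist y (T x) ≤ e n := Metric.closure_ball_subset_closedBall hy
        have := (hrφ (hd.trans_lt (hN n hn.le))).le
        rwa [Real.dist_eq] at this
      have h4 := norm_integral_le_of_norm_le_const hb
      rw [integral_sub hi (integrable_const _)] at h4
      simpa using h4
    rw [dist_zero_right, ← integral_kernel_of_stationary (P := P n) (hμ n).2.1 hφ ⟨_, hC⟩]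
    have hi1 : Integrable (fun x => ∫ y, φ y ∂P n x) (μ n) :=
      Integrable.of_bound (measurable_kernel_integral hφ).aestronglyMeasurable _
        (.of_forall (abs_kernel_integral_le hC))
    have hi2 : Integrable (fun x => φ (T x)) (μ n) :=
      Integrable.of_bound (hφ.comp hT).aestronglyMeasurable _ (.of_forall fun x => hC (T x))
    rw [← integral_sub hi1 hi2]
    have h5 := norm_integral_le_of_norm_le_const (μ := μ n)
      (f := fun x => ∫ y, φ y ∂P n x - φ (T x)) (C := δ / 2) (.of_forall hloc)
    simp only [probReal_univ, mul_one] at h5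
    linarith
  have h3 := tendsto_nhds_unique hdiff (h1.sub h2)
  linarith

end Limits

section Perturbed

variable {X : Type*} [PseudoMetricSpace X] [MeasurableSpace X] {T : X → X} {m : Measure X}

/-- An almost everywhere continuous map `T` and Markov kernels `P ε` which spread `T x` over its
`ε`-ball, such that the transfer operators of `T` and of `P ε`, `ε < ε₁`, satisfy the same
Lasota-Yorke inequality on `B`. -/
structure PerturbedSystem (hT : Measurable T) (P : ℝ → Kernel X X) (B : Submodule ℝ (X →₁[m] ℝ))
    (s : Seminorm ℝ B) (η D ε₁ : ℝ) : Prop where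
  null_discontinuities : m {x | ¬ ContinuousAt T x} = 0
  null_sphere : ∀ (x : X) (r : ℝ), 0 < r → m (Metric.sphere x r) = 0
  markov : ∀ ε > 0, IsMarkovKernel (P ε)
  absolutelyContinuous : ∀ ε > 0, ∀ x, P ε x ≪ m
  support_eq : ∀ ε > 0, ∀ x, (P ε x).support = closure (Metric.ball (T x) ε)
  adapted : IsAdaptedSpace m B s
  eta_nonneg : 0 ≤ η
  eta_lt_one : η < 1
  bound_nonneg : 0 ≤ D
  pos : 0 < ε₁
  lasotaYorke : LasotaYorke (Kernel.deterministic T hT) s η D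
  random_lasotaYorke : ∀ ε, 0 < ε → ε < ε₁ → LasotaYorke (P ε) s η D

namespace PerturbedSystem

variable {hT : Measurable T} {P : ℝ → Kernel X X} {B : Submodule ℝ (X →₁[m] ℝ)}
  {s : Seminorm ℝ B} {η D ε₁ ε : ℝ} {μ ν ρ : Measure X}

/-- A compact subset of `L¹(m)` which contains the densities of all acims of `T` and of all acsms of
`P ε` with `ε < ε₁`. -/
lemma exists_compact (H : PerturbedSystem hT P B s η D ε₁) :
    ∃ K : Set (X →₁[m] ℝ), IsCompact K ∧ K ⊆ B ∧
      (∀ μ h, IsAcsm (Kernel.deterministic T hT) m μ → IsDensity m μ h → h ∈ K) ∧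
      ∀ ε, 0 < ε → ε < ε₁ → ∀ μ h, IsAcsm (P ε) m μ → IsDensity m μ h → h ∈ K := by
  have hK : 0 ≤ D / (1 - η) := div_nonneg H.bound_nonneg (by linarith [H.eta_lt_one])
  refine ⟨strongBall s (2 * (D / (1 - η)) + 3),
    isCompact_strongBall H.adapted.isCompact_unitBall (by linarith), fun f hf => hf.1, ?_, ?_⟩
  · intro μ h hμ hh
    have := hμ.1
    exact H.lasotaYorke.mem_strongBall H.eta_nonneg H.eta_lt_one H.bound_nonneg
      H.adapted.isCompact_unitBall H.adapted.dense (hh.isAcsm_iff.1 hμ) hh.norm_eq_one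
  · intro ε h0 h1 μ h hμ hh
    have := hμ.1
    have := H.markov ε h0
    exact (H.random_lasotaYorke ε h0 h1).mem_strongBall H.eta_nonneg H.eta_lt_one H.bound_nonneg
      H.adapted.isCompact_unitBall H.adapted.dense (hh.isAcsm_iff.1 hμ) hh.norm_eq_one

lemma exists_isOpenCarrier [BorelSpace X] [SigmaFinite m]
    (H : PerturbedSystem hT P B s η D ε₁) (h0 : 0 < ε) (h1 : ε < ε₁)
    (hμ : IsAcsm (P ε) m μ) : ∃ W, IsOpenCarrier m μ W := by
  obtain ⟨K, -, hKB, -, hK⟩ := H.exists_compact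
  have := hμ.1
  obtain ⟨h, hh⟩ := exists_isDensity hμ.2.2
  obtain ⟨g, hg, hgc⟩ := H.adapted.ae_continuous h (hKB (hK ε h0 h1 μ h hμ hh))
  exact hh.exists_isOpenCarrier hg hgc

lemma exists_isOpenCarrier_acim [BorelSpace X] [SigmaFinite m]
    (H : PerturbedSystem hT P B s η D ε₁) (hμ : IsErgodicAcim T m μ) :
    ∃ W, IsOpenCarrier m μ W := by
  obtain ⟨K, -, hKB, hK, -⟩ := H.exists_compact
  have := hμ.1
  obtain ⟨h, hh⟩ := exists_isDensity hμ.2.2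
  obtain ⟨g, hg, hgc⟩ := H.adapted.ae_continuous h (hKB (hK μ h (hμ.isAcsm hT) hh))
  exact hh.exists_isOpenCarrier hg hgc

/-- Two ergodic acsms whose supports both contain the support of an acim coincide: otherwise they
would be mutually singular and have disjoint carriers, yet both carriers are dense in the open
carrier of the acim. -/
lemma eq_of_support_subset [BorelSpace X] [IsFiniteMeasure m] [m.IsOpenPosMeasure]
    (H : PerturbedSystem hT P B s η D ε₁) {μ₁ : Measure X} (hμ₁ : IsErgodicAcim T m μ₁)
    (h0 : 0 < ε) (h1 : ε < ε₁) (hμ : IsAcsm (P ε) m μ) (hμe : IsErgodicStationary (P ε) μ)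
    (hμs : μ₁.support ⊆ μ.support) (hν : IsAcsm (P ε) m ν) (hνe : IsErgodicStationary (P ε) ν)
    (hνs : μ₁.support ⊆ ν.support) : μ = ν := by
  have := H.markov ε h0
  have := hμ₁.1
  by_contra hne
  obtain ⟨W, hW⟩ := H.exists_isOpenCarrier h0 h1 hμ
  obtain ⟨W', hW'⟩ := H.exists_isOpenCarrier h0 h1 hν
  obtain ⟨W₁, hW₁⟩ := H.exists_isOpenCarrier_acim hμ₁
  have hdisj := hW.disjoint hW' (hμ.mutuallySingular hμe hν hνe hne)
  obtain ⟨x, hx, -⟩ := hW₁.inter_nonempty (A := Set.univ) (by simp)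
  have h2 : μ W₁ ≠ 0 := measure_ne_zero_of_inter_support hW₁.isOpen
    ⟨x, hx, hμs (hW₁.subset_support hx)⟩
  obtain ⟨y, hyW, hyW₁⟩ := hW.inter_nonempty h2
  have h3 : ν (W ∩ W₁) ≠ 0 := measure_ne_zero_of_inter_support (hW.isOpen.inter hW₁.isOpen)
    ⟨y, ⟨hyW, hyW₁⟩, hνs (hW₁.subset_support hyW₁)⟩
  obtain ⟨z, hzW', hzW, -⟩ := hW'.inter_nonempty h3
  exact Set.disjoint_left.1 hdisj hzW hzW'

variable [SecondCountableTopology X] [BorelSpace X]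

/-- If the carrier of an acsm `μ` meets the support of an ergodic acim `ρ` and `ρ → ν`, then the
support of `μ` contains the support of `ν`. -/
lemma support_subset_support [m.IsOpenPosMeasure]
    (H : PerturbedSystem hT P B s η D ε₁) (h0 : 0 < ε)
    (hμ : IsAcsm (P ε) m μ) {W : Set X} (hW : IsOpenCarrier m μ W) (hρ : IsErgodicAcim T m ρ)
    (hν : IsErgodicAcim T m ν) (hρν : Leads T ρ ν) (h : (W ∩ ρ.support).Nonempty) :
    ν.support ⊆ μ.support := by
  have hinv := hμ.isPseudoInvariant_support (H.support_eq ε h0)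
  have hm : MeasurableSet μ.support := Measure.isClosed_support.measurableSet
  have h2 : ρ μ.support ≠ 0 := fun h3 => measure_ne_zero_of_inter_support hW.isOpen h
    (measure_mono_null hW.subset_support h3)
  exact hν.support_subset H.null_discontinuities h0 hm hinv
    (hρν.measure_ne_zero hρ H.null_discontinuities h0 hm hinv h2)

/-- The set reached from an ergodic acim supports an ergodic acsm. -/
lemma exists_ergodic_acsm [IsFiniteMeasure m]
    (H : PerturbedSystem hT P B s η D ε₁) {μ₁ : Measure X} (hμ₁ : IsErgodicAcim T m μ₁)
    (h0 : 0 < ε) (h1 : ε < ε₁) :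
    ∃ μ, IsAcsm (P ε) m μ ∧ IsErgodicStationary (P ε) μ ∧ μ (reach T ε μ₁.support)ᶜ = 0 := by
  have := H.markov ε h0
  have := hμ₁.1
  obtain ⟨K, hKc, hKB, hKT, hKP⟩ := H.exists_compact
  obtain ⟨f, hf⟩ := exists_isDensity hμ₁.2.2
  have hopen := hμ₁.isOpen_reach H.null_discontinuities h0
  have hfU : ∀ᵐ x ∂m, x ∉ reach T ε μ₁.support → f x = 0 :=
    (hf.apply_eq_zero_iff hopen.measurableSet.compl).1 (measure_mono_null
      (Set.compl_subset_compl.2 subset_reach) Measure.measure_compl_support)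
  have habs : ∀ᵐ x ∂m, x ∈ reach T ε μ₁.support → P ε x (reach T ε μ₁.support)ᶜ = 0 :=
    isPseudoInvariant_reach.ae_absorbing h0 H.null_discontinuities H.null_sphere
      (H.absolutelyContinuous ε h0) (H.support_eq ε h0)
  obtain ⟨μ, hμ, hμU⟩ := (H.random_lasotaYorke ε h0 h1).exists_isAcsm H.eta_nonneg H.eta_lt_one
    H.bound_nonneg H.adapted.isCompact_unitBall hopen.measurableSet habs
    ⟨f, hKB (hKT _ _ (hμ₁.isAcsm hT) hf)⟩ hf.nonneg (by rw [← hf.norm_eq, hf.norm_eq_one]) hfU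
  obtain ⟨μ', hμ', he, hac⟩ := hμ.exists_ergodic hKc (hKP ε h0 h1)
  exact ⟨μ', hμ', he, hac hμU⟩

variable [SigmaFinite m] [m.IsOpenPosMeasure]

/-- If `μ₁ → ν₁` but no `ε`-pseudo-orbit returns from `ν₁` to `μ₁`, then acsms of `P ε` do not
charge the supports of acims in the class of `μ₁`. Indeed, an acsm which does charges the support of
`μ₁`. Its restriction to the complement of the set reached from `ν₁`, an absorbing set which misses
the support of `μ₁`, is again stationary and still charges the support of `μ₁`, so its support
contains that of `ν₁`; but it vanishes near the support of `ν₁`. -/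
lemma inter_support_eq_empty (H : PerturbedSystem hT P B s η D ε₁) (h0 : 0 < ε) (h1 : ε < ε₁)
    {μ₁ ν₁ : Measure X} (hμ₁ : IsErgodicAcim T m μ₁) (hν₁ : IsErgodicAcim T m ν₁)
    (hlead : Leads T μ₁ ν₁) (hno : reach T ε ν₁.support ∩ μ₁.support = ∅)
    (hμ : IsAcsm (P ε) m μ) {W : Set X} (hW : IsOpenCarrier m μ W)
    (hρ : IsErgodicAcim T m ρ) (hρμ : Leads T ρ μ₁) : W ∩ ρ.support = ∅ := by
  have := H.markov ε h0
  have := hμ.1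
  have := hμ₁.1
  rw [← Set.not_nonempty_iff_eq_empty]
  intro hne
  have hsub := H.support_subset_support h0 hμ hW hρ hμ₁ hρμ hne
  obtain ⟨W₁, hW₁⟩ := H.exists_isOpenCarrier_acim hμ₁
  have hW₁ne : W₁.Nonempty := (hW₁.inter_nonempty (A := Set.univ) (by simp)).mono
    Set.inter_subset_left
  set U := reach T ε ν₁.support
  have hUo : IsOpen U := hν₁.isOpen_reach H.null_discontinuities h0
  have hWU : W₁ ⊆ Uᶜ := fun x hx hxU =>
    Set.eq_empty_iff_forall_notMem.1 hno x ⟨hxU, hW₁.subset_support hx⟩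
  have hμW₁ : μ W₁ ≠ 0 := measure_ne_zero_of_inter_support hW₁.isOpen
    (hW₁ne.mono fun x hx => ⟨hx, hsub (hW₁.subset_support hx)⟩)
  have hμU : μ Uᶜ ≠ 0 := fun h => hμW₁ (measure_mono_null hWU h)
  have habs : ∀ᵐ x ∂m, x ∈ U → P ε x Uᶜ = 0 := isPseudoInvariant_reach.ae_absorbing h0
    H.null_discontinuities H.null_sphere (H.absolutelyContinuous ε h0) (H.support_eq ε h0)
  have hinv := ae_eq_indicator_of_absorbing hμ.2.1 hUo.measurableSet (hμ.2.2.ae_le (habs.mono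
    fun x hx hxU => (prob_compl_eq_zero_iff hUo.measurableSet).1 (hx hxU)))
  -- both `U` and its complement are invariant, so `μ` may be conditioned on the latter
  have hμ' := hμ.cond hUo.measurableSet.compl
    (ae_compl_eq_indicator hUo.measurableSet hinv) hμU
  have hμ'W₁ : μ[|Uᶜ] W₁ ≠ 0 := by
    rw [cond_apply hUo.measurableSet.compl, Set.inter_eq_self_of_subset_right hWU]
    exact mul_ne_zero (ENNReal.inv_ne_zero.2 (measure_ne_top _ _)) hμW₁
  obtain ⟨W', hW'⟩ := H.exists_isOpenCarrier h0 h1 hμ'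
  have hsub' := H.support_subset_support h0 hμ' hW' hμ₁ hν₁ hlead
    ((hW'.inter_nonempty hμ'W₁).mono (Set.inter_subset_inter_right _ hW₁.subset_support))
  obtain ⟨x, hx⟩ := hν₁.support_nonempty
  refine measure_ne_zero_of_inter_support hUo ⟨x, subset_reach hx, hsub' hx⟩ ?_
  rw [cond_apply hUo.measurableSet.compl, Set.compl_inter_self, measure_empty, mul_zero]

/-- If every acim reached from `μ₁` leads back to `μ₁`, then for small `ε` all acsms of `P ε` living
on the set reached from `μ₁` charge the support of `μ₁`. Otherwise there would be a limit acim, as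
`ε → 0`, with an ergodic component that is reached from `μ₁` but does not lead back. -/
lemma exists_support_subset [CompactSpace X] [IsFiniteMeasure m]
    (H : PerturbedSystem hT P B s η D ε₁) {μ₁ : Measure X} (hμ₁ : IsErgodicAcim T m μ₁)
    (hleast : ∀ ν, IsErgodicAcim T m ν → Leads T μ₁ ν → Leads T ν μ₁) :
    ∃ ε₀ > 0, ε₀ ≤ ε₁ ∧ ∀ ε, 0 < ε → ε < ε₀ → ∀ μ, IsAcsm (P ε) m μ →
      μ (reach T ε μ₁.support)ᶜ = 0 → μ₁.support ⊆ μ.support := by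
  by_contra! hcon
  choose e he0 he μ hμ hμU hμ₁s using fun n : ℕ => hcon (min ε₁ (1 / ((n : ℝ) + 1)))
    (lt_min H.pos (by positivity)) (min_le_left _ _)
  have heε₁ : ∀ n, e n < ε₁ := fun n => (he n).trans_le (min_le_left _ _)
  obtain ⟨K, hKc, -, hKT, hKP⟩ := H.exists_compact
  choose f hf using fun n => have := (hμ n).1; exists_isDensity (hμ n).2.2
  obtain ⟨h, -, ψ, hψ, hlim⟩ := hKc.tendsto_subseq
    fun n => hKP _ (he0 n) (heε₁ n) _ _ (hμ n) (hf n)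
  obtain ⟨ν, hν, hνh, hconv⟩ := exists_measure_of_tendsto (fun n => (hμ (ψ n)).1)
    (fun n => hf (ψ n)) hlim
  have helim : Tendsto (fun n => e (ψ n)) atTop (𝓝 0) :=
    squeeze_zero (fun n => (he0 _).le) (fun n => ((he _).trans_le (min_le_right _ _)).le)
      (tendsto_one_div_add_atTop_nhds_zero_nat.comp hψ.tendsto_atTop)
  have hνT : MeasurePreserving T ν ν := measurePreserving_of_tendsto hT helim
    (fun n => H.markov _ (he0 _)) (fun n => H.support_eq _ (he0 _)) (fun n => hμ (ψ n)) hconv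
  obtain ⟨μ', hμ', hμ'e, hμ'ν⟩ := IsAcsm.exists_ergodic hKc hKT
    ((isAcsm_deterministic_iff hT).2 ⟨hν, hνT, hνh.absolutelyContinuous⟩)
  have hE := hμ'.isErgodicAcim hT hμ'e
  have := hE.1
  have hlead : Leads T μ₁ μ' := by
    refine leads_iff.2 fun δ hδ => ?_
    have hopen := hμ₁.isOpen_reach H.null_discontinuities hδ
    have h2 : ∀ᵐ x ∂μ', x ∈ reach T δ μ₁.support := by
      refine mem_ae_iff.2 (hμ'ν (measure_eq_zero_of_tendsto hconv hopen.measurableSet.compl ?_))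
      filter_upwards [helim.eventually_lt_const hδ] with n hn
      exact measure_mono_null (Set.compl_subset_compl.2 (reach_mono hn.le)) (hμU (ψ n))
    exact (h2.and Measure.support_mem_ae).exists
  have hback := hleast μ' hE hlead
  -- so no `μ n` charges the support of `μ'`, and neither does the limit `ν`, although `μ' ≪ ν`
  have hzero : ∀ n, μ n μ'.support = 0 := by
    intro n
    by_contra hne
    obtain ⟨W, hW⟩ := H.exists_isOpenCarrier (he0 n) (heε₁ n) (hμ n)
    exact hμ₁s n (H.support_subset_support (he0 n) (hμ n) hW hE hμ₁ hback (hW.inter_nonempty hne))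
  have h3 : μ' μ'.support = 0 := hμ'ν (measure_eq_zero_of_tendsto hconv
    Measure.isClosed_support.measurableSet (.of_forall fun n => hzero (ψ n)))
  have h4 : μ' Set.univ = 0 := by
    rw [← Set.union_compl_self μ'.support]
    exact measure_union_null h3 Measure.measure_compl_support
  exact IsProbabilityMeasure.ne_zero μ' (Measure.measure_univ_eq_zero.1 h4)

end PerturbedSystem

end Perturbed

/-! ### Normalized Lebesgue measure -/

section NormalizedLebesgue

variable {q : ℕ} {M : Set (EuclideanSpace ℝ (Fin q))}

lemma normalizedLebesgue_apply (hM : IsCompact M) (A : Set M) :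
    normalizedLebesgue M A = (volume M)⁻¹ * volume (Subtype.val '' A) := by
  rw [normalizedLebesgue, Measure.smul_apply, smul_eq_mul,
    (MeasurableEmbedding.subtype_coe hM.measurableSet).comap_apply]

lemma isFiniteMeasure_normalizedLebesgue (hM : IsCompact M) (hne : M.Nonempty)
    (hint : closure (interior M) = M) : IsFiniteMeasure (normalizedLebesgue M) := by
  refine ⟨?_⟩
  rw [normalizedLebesgue_apply hM, Set.image_univ, Subtype.range_coe]
  have h0 : 0 < volume M := by
    refine (isOpen_interior.measure_pos volume ?_).trans_le (measure_mono interior_subset)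
    rw [← closure_nonempty_iff, hint]
    exact hne
  exact ENNReal.mul_lt_top (ENNReal.inv_lt_top.2 h0) hM.measure_lt_top

/-- Since `M` is the closure of its interior, a nonempty open subset of `M` contains a nonempty open
subset of the ambient space. -/
lemma isOpenPosMeasure_normalizedLebesgue (hM : IsCompact M)
    (hint : closure (interior M) = M) : (normalizedLebesgue M).IsOpenPosMeasure := by
  refine ⟨fun U hU hUne => ?_⟩
  obtain ⟨V, hV, rfl⟩ := isOpen_induced_iff.1 hU
  obtain ⟨x, hx⟩ := hUne
  have hxc : (x : EuclideanSpace ℝ (Fin q)) ∈ closure (interior M) := by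
    rw [hint]
    exact x.2
  have hpos : 0 < volume (V ∩ interior M) :=
    (hV.inter isOpen_interior).measure_pos volume (mem_closure_iff.1 hxc V hV hx)
  rw [normalizedLebesgue_apply hM]
  refine mul_ne_zero (ENNReal.inv_ne_zero.2 hM.measure_lt_top.ne) (hpos.trans_le ?_).ne'
  exact measure_mono fun y hy => ⟨⟨y, interior_subset hy.2⟩, hy.1, rfl⟩

lemma normalizedLebesgue_sphere (hM : IsCompact M) (x : M) {r : ℝ} (hr : 0 < r) :
    normalizedLebesgue M (Metric.sphere x r) = 0 := by
  rw [normalizedLebesgue_apply hM]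
  refine mul_eq_zero_of_right _ (measure_mono_null ?_
    (Measure.addHaar_sphere_of_ne_zero volume (x : EuclideanSpace ℝ (Fin q)) hr.ne'))
  rintro _ ⟨y, hy, rfl⟩
  exact hy

end NormalizedLebesgue

/-! ### Least and non-least classes -/

section Classes

variable {X : Type*} [PseudoMetricSpace X] [SecondCountableTopology X] [MeasurableSpace X]
  [BorelSpace X] {T : X → X} {m : Measure X} {hT : Measurable T} {P : ℝ → Kernel X X}
  {B : Submodule ℝ (X →₁[m] ℝ)} {s : Seminorm ℝ B} {η D ε₁ : ℝ} {μ₁ : Measure X}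
  {C : Set (Measure X)}

/-- From a member of a least class one only reaches acims which lead back. -/
lemma IsLeastElement.leads_back (hdisc : m {x | ¬ ContinuousAt T x} = 0)
    (hμ₁ : IsErgodicAcim T m μ₁)
    (h : IsLeastElement T m {ν | IsErgodicAcim T m ν ∧ Leads T μ₁ ν ∧ Leads T ν μ₁})
    {ν : Measure X} (hν : IsErgodicAcim T m ν) (hlead : Leads T μ₁ ν) : Leads T ν μ₁ := by
  by_contra hback
  refine h {ρ | IsErgodicAcim T m ρ ∧ Leads T ν ρ ∧ Leads T ρ ν} ⟨ν, hν, rfl⟩ (fun heq => ?_) ?_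
  · have hmem : ν ∈ {ρ | IsErgodicAcim T m ρ ∧ Leads T ν ρ ∧ Leads T ρ ν} :=
      ⟨hν, Leads.refl hν, Leads.refl hν⟩
    rw [heq] at hmem
    exact hback hmem.2.2
  · rintro μ ⟨hμ, -, hμμ₁⟩ ρ ⟨-, hνρ, -⟩
    exact (hμμ₁.trans hlead hμ hμ₁ hdisc).trans hνρ hμ hν hdisc

/-- From a class which is not least one reaches an acim which does not lead back. -/
lemma exists_leads_not_back (hdisc : m {x | ¬ ContinuousAt T x} = 0)
    (hμ₁ : IsErgodicAcim T m μ₁)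
    (h : ¬ IsLeastElement T m {ν | IsErgodicAcim T m ν ∧ Leads T μ₁ ν ∧ Leads T ν μ₁}) :
    ∃ ν, IsErgodicAcim T m ν ∧ Leads T μ₁ ν ∧ ¬ Leads T ν μ₁ := by
  unfold IsLeastElement at h
  push Not at h
  obtain ⟨_, ⟨ν, hν, rfl⟩, hne, hCC⟩ := h
  have hlead : Leads T μ₁ ν := hCC μ₁ ⟨hμ₁, Leads.refl hμ₁, Leads.refl hμ₁⟩ ν
    ⟨hν, Leads.refl hν, Leads.refl hν⟩
  refine ⟨ν, hν, hlead, fun hback => hne ?_⟩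
  ext ρ
  constructor
  · rintro ⟨hρ, h1, h2⟩
    exact ⟨hρ, hlead.trans h1 hμ₁ hν hdisc, h2.trans hback hρ hν hdisc⟩
  · rintro ⟨hρ, h1, h2⟩
    exact ⟨hρ, hback.trans h1 hν hμ₁ hdisc, h2.trans hlead hρ hμ₁ hdisc⟩

namespace PerturbedSystem

/-- For a least class, the set of points reached by `ε`-pseudo-orbits from one of its members is the
required neighbourhood. -/
theorem exists_open_of_least [CompactSpace X] [IsFiniteMeasure m] [m.IsOpenPosMeasure]
    (H : PerturbedSystem hT P B s η D ε₁) (hC : IsPseudoOrbitClass T m C)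
    (hleast : IsLeastElement T m C) : ∃ ε₀ > 0, ∀ ε, 0 < ε → ε < ε₀ →
      ∃ U : Set X, IsOpen U ∧ classCarrier C ⊆ U ∧
        (∀ x ∈ U, ContinuousAt T x → Metric.ball (T x) ε ⊆ U) ∧
        ∃! μ : Measure X, IsAcsm (P ε) m μ ∧ IsErgodicStationary (P ε) μ ∧ μ Uᶜ = 0 := by
  obtain ⟨μ₁, hμ₁, rfl⟩ := hC
  obtain ⟨ε₀, hε₀, hle, hsub⟩ := H.exists_support_subset hμ₁
    fun ν hν => hleast.leads_back H.null_discontinuities hμ₁ hν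
  refine ⟨ε₀, hε₀, fun ε h0 h1 => ⟨reach T ε μ₁.support,
    hμ₁.isOpen_reach H.null_discontinuities h0, ?_, isPseudoInvariant_reach, ?_⟩⟩
  · refine Set.iUnion₂_subset fun ν hν => ?_
    exact hν.2.1.support_subset_reach hμ₁ hν.1 H.null_discontinuities h0
  · obtain ⟨μ, hμ, hμe, hμU⟩ := H.exists_ergodic_acsm hμ₁ h0 (h1.trans_le hle)
    refine ⟨μ, ⟨hμ, hμe, hμU⟩, ?_⟩
    rintro ν ⟨hν, hνe, hνU⟩
    exact H.eq_of_support_subset hμ₁ h0 (h1.trans_le hle) hν hνe (hsub ε h0 h1 ν hν hνU) hμ hμe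
      (hsub ε h0 h1 μ hμ hμU)

/-- For a class which is not least, the open carriers of the acsms of `P ε` with small `ε` avoid the
whole class. -/
lemma exists_disjoint_classCarrier [SigmaFinite m] [m.IsOpenPosMeasure]
    (H : PerturbedSystem hT P B s η D ε₁) (hC : IsPseudoOrbitClass T m C)
    (hleast : ¬ IsLeastElement T m C) : ∃ ε₀ > 0, ε₀ ≤ ε₁ ∧ ∀ ε, 0 < ε → ε < ε₀ → ∀ μ,
      IsAcsm (P ε) m μ → ∃ W, IsOpen W ∧ μ Wᶜ = 0 ∧ classCarrier C ⊆ Wᶜ := by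
  obtain ⟨μ₁, hμ₁, rfl⟩ := hC
  obtain ⟨ν₁, hν₁, hlead, hback⟩ := exists_leads_not_back H.null_discontinuities hμ₁ hleast
  rw [leads_iff] at hback
  push Not at hback
  obtain ⟨δ, hδ, hno⟩ := hback
  refine ⟨min δ ε₁, lt_min hδ H.pos, min_le_right _ _, fun ε h0 h1 μ hμ => ?_⟩
  rw [lt_min_iff] at h1
  obtain ⟨W, hW⟩ := H.exists_isOpenCarrier h0 h1.2 hμ
  refine ⟨W, hW.isOpen, hW.measure_compl, Set.iUnion₂_subset fun ρ hρ x hx hxW => ?_⟩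
  have := H.inter_support_eq_empty h0 h1.2 hμ₁ hν₁ hlead
    (Set.subset_eq_empty (Set.inter_subset_inter_left _ (reach_mono h1.1.le)) hno) hμ hW hρ.1
    hρ.2.2
  exact Set.eq_empty_iff_forall_notMem.1 this x ⟨hxW, hx⟩

/-- The densities of acsms converge in `L¹(m)` along a subsequence, so that null sets of the acsms
are null sets of their weak limits. -/
theorem weak_limit_classCarrier_eq_zero [SigmaFinite m] [m.IsOpenPosMeasure]
    (H : PerturbedSystem hT P B s η D ε₁) (hC : IsPseudoOrbitClass T m C)
    (hleast : ¬ IsLeastElement T m C) {e : ℕ → ℝ} {μ : ℕ → ProbabilityMeasure X}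
    {ν : ProbabilityMeasure X} (he0 : ∀ k, 0 < e k) (he : Tendsto e atTop (𝓝 0))
    (hμ : ∀ k, IsAcsm (P (e k)) m (μ k)) (hlim : Tendsto μ atTop (𝓝 ν)) :
    (ν : Measure X) (classCarrier C) = 0 := by
  obtain ⟨ε₀, hε₀, hle, hW⟩ := H.exists_disjoint_classCarrier hC hleast
  obtain ⟨N, hN⟩ := eventually_atTop.1 (he.eventually_lt_const hε₀)
  have heN : ∀ n, e (n + N) < ε₀ := fun n => hN _ (Nat.le_add_left _ _)
  choose W hWo hμW hCW using fun n => hW _ (he0 (n + N)) (heN n) _ (hμ (n + N))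
  obtain ⟨K, hKc, -, -, hKP⟩ := H.exists_compact
  choose f hf using fun n => exists_isDensity (m := m) (hμ (n + N)).2.2
  obtain ⟨h, -, ψ, hψ, hfh⟩ := hKc.tendsto_subseq
    fun n => hKP _ (he0 _) ((heN n).trans_le hle) _ _ (hμ (n + N)) (hf n)
  obtain ⟨ν', hν', -, hconv⟩ := exists_measure_of_tendsto (fun n => (hμ (ψ n + N)).1)
    (fun n => hf (ψ n)) hfh
  have hψN : Tendsto (fun n => ψ n + N) atTop atTop :=
    (tendsto_add_atTop_nat N).comp hψ.tendsto_atTop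
  have heq : ν' = ν := by
    refine ext_of_forall_integral_eq_of_IsFiniteMeasure fun φ => ?_
    refine tendsto_nhds_unique (hconv φ φ.continuous.measurable ⟨_, φ.norm_coe_le_norm⟩) ?_
    exact (ProbabilityMeasure.tendsto_iff_forall_integral_tendsto.1 hlim φ).comp hψN
  have hmeas : MeasurableSet (⋂ n, (W n)ᶜ) := .iInter fun n => (hWo n).measurableSet.compl
  rw [← heq]
  exact measure_mono_null (Set.subset_iInter hCW) (measure_eq_zero_of_tendsto hconv hmeas
    (.of_forall fun n => measure_mono_null (Set.iInter_subset _ (ψ n)) (hμW (ψ n))))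

end PerturbedSystem

end Classes

end PseudoOrbits

theorem theorem1 {q : ℕ} (M : Set (EuclideanSpace ℝ (Fin q)))
    (hMne : M.Nonempty) (hMcpt : IsCompact M) (hMint : closure (interior M) = M)
    (m : Measure M) (hm : m = PseudoOrbits.normalizedLebesgue M)
    -- the unperturbed map: measurable, nonsingular, almost everywhere continuous
    (T : M → M) (hT : Measure.QuasiMeasurePreserving T m m)
    (hTdisc : m {x | ¬ ContinuousAt T x} = 0)
    -- the transition probabilities and their densities
    (P : ℝ → Kernel M M) (hP : ∀ ε > 0, IsMarkovKernel (P ε))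
    (p : ℝ → M → M → ℝ≥0∞)
    (hP1 : ∀ ε > 0, Measurable (fun z : M × M => p ε z.1 z.2) ∧
      ∀ x, P ε x = m.withDensity (p ε x))
    (hP2 : ∀ ε > 0, ∀ x, (P ε x).support = closure (Metric.ball (T x) ε))
    -- the Banach space
    (B : Submodule ℝ (M →₁[m] ℝ)) (s : Seminorm ℝ B)
    (hB : PseudoOrbits.IsAdaptedSpace m B s)
    -- the uniform Lasota-Yorke inequalities, with the invariance of `B` that they presuppose
    (η D ε₁ : ℝ) (hη₀ : 0 < η) (hη₁ : η < 1) (hD : 0 < D) (hε₁ : 0 < ε₁)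
    (hLY : ∀ f : B, ∃ g : B, PseudoOrbits.IsPerronFrobenius T m f g ∧
      s g ≤ η * s f + D * ‖(f : M →₁[m] ℝ)‖)
    (hRLY : ∀ ε, 0 < ε → ε < ε₁ → ∀ f : B, ∃ g : B,
      (∀ᵐ x ∂m, (g : M →₁[m] ℝ) x = PseudoOrbits.randomTransfer m (p ε) f x) ∧
      s g ≤ η * s f + D * ‖(f : M →₁[m] ℝ)‖)
    (C : Set (Measure M)) (hC : PseudoOrbits.IsPseudoOrbitClass T m C) :
    (PseudoOrbits.IsLeastElement T m C →
      ∃ ε₀ > 0, ∀ ε, 0 < ε → ε < ε₀ →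
        ∃ U : Set M, IsOpen U ∧ PseudoOrbits.classCarrier C ⊆ U ∧
          (∀ x ∈ U, ContinuousAt T x → Metric.ball (T x) ε ⊆ U) ∧
          ∃! μ : Measure M, PseudoOrbits.IsAcsm (P ε) m μ ∧
            PseudoOrbits.IsErgodicStationary (P ε) μ ∧ μ Uᶜ = 0) ∧
    (¬ PseudoOrbits.IsLeastElement T m C →
      (∃ ε₀ > 0, ∀ ε, 0 < ε → ε < ε₀ → ∀ μ : Measure M,
        PseudoOrbits.IsAcsm (P ε) m μ → μ (PseudoOrbits.classCarrier C) = 0) ∧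
      (∀ (e : ℕ → ℝ) (μ : ℕ → ProbabilityMeasure M) (ν : ProbabilityMeasure M),
        (∀ k, 0 < e k) → Tendsto e atTop (𝓝 0) →
        (∀ k, PseudoOrbits.IsAcsm (P (e k)) m (μ k)) → Tendsto μ atTop (𝓝 ν) →
        (ν : Measure M) (PseudoOrbits.classCarrier C) = 0)) := by
  have : CompactSpace M := isCompact_iff_compactSpace.1 hMcpt
  have hfin : IsFiniteMeasure m :=
    hm ▸ PseudoOrbits.isFiniteMeasure_normalizedLebesgue hMcpt hMne hMint
  have hpos : m.IsOpenPosMeasure :=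
    hm ▸ PseudoOrbits.isOpenPosMeasure_normalizedLebesgue hMcpt hMint
  have H : PseudoOrbits.PerturbedSystem hT.measurable P B s η D ε₁ :=
    { null_discontinuities := hTdisc
      null_sphere := fun x r hr => hm ▸ PseudoOrbits.normalizedLebesgue_sphere hMcpt x hr
      markov := hP
      absolutelyContinuous := fun ε hε x =>
        (hP1 ε hε).2 x ▸ withDensity_absolutelyContinuous _ _
      support_eq := hP2
      adapted := hB
      eta_nonneg := hη₀.le
      eta_lt_one := hη₁
      bound_nonneg := hD.le
      pos := hε₁
      lasotaYorke := fun f =>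
        let ⟨g, hg, hs⟩ := hLY f
        ⟨g, PseudoOrbits.isTransfer_deterministic hT.measurable hg, hs⟩
      random_lasotaYorke := fun ε h0 h1 f =>
        let ⟨g, hg, hs⟩ := hRLY ε h0 h1 f
        have := hP ε h0
        ⟨g, PseudoOrbits.isTransfer_of_randomTransfer (hP1 ε h0).1 (hP1 ε h0).2 hg, hs⟩ }
  refine ⟨H.exists_open_of_least hC, fun hleast => ⟨?_, ?_⟩⟩
  · obtain ⟨ε₀, hε₀, -, hW⟩ := H.exists_disjoint_classCarrier hC hleast
    refine ⟨ε₀, hε₀, fun ε h0 h1 μ hμ => ?_⟩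
    obtain ⟨W, -, hμW, hCW⟩ := hW ε h0 h1 μ hμ
    exact measure_mono_null hCW hμW
  · intro e μ ν he0 he hμ hlim
    exact H.weak_limit_classCarrier_eq_zero hC hleast he0 he hμ hlim
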